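/- Let $C_0>c>0$ and let $q_0:\mathbb R\to\mathbb R$ be measurable with $\int_0^\infty e^{C_0x}\big(|q_0(x)|+|q_0(-x)+c^2|\big)dx<\infty$. For $k=\mathrm is$, $0<s<c$, and $k_1=\sqrt{k^2+c^2}>0$ let $\phi(k,\cdot),\phi_1(k,\cdot)$ be the Jost solutions of $-y''+q_0y=k^2y$ with $\phi\sim e^{\mathrm ikx}$ as $x\to+\infty$ and $\phi_1\sim e^{-\mathrm ik_1x}$ as $x\to-\infty$, let $w=\phi_1\phi'-\phi_1'\phi$ be their Wronskian, and let $T=2\mathrm ik/w$, $T_1=2\mathrm ik_1/w$ be the transmission coefficients. For $\xi\in(-c^2/2,c^2/3)$ let $a=a(\xi)\in(0,c)$ be the unique solution of $$\int_{0}^{a}\Big(\xi+\tfrac{c^2-a^2}{2}-s^2\Big)\sqrt{\tfrac{a^2-s^2}{c^2-s^2}}\,ds=0,$$ and put (positive roots) $J(\xi)=\int_{-a}^{a}\frac{ds}{\sqrt{(c^2-s^2)(a^2-s^2)}}$, $\Gamma(\xi)=-\frac1{2J(\xi)}$, $$B(\xi)=24\int_a^c\Big(\xi+\tfrac{c^2-a^2}2-s^2\Big)\sqrt{\tfrac{s^2-a^2}{c^2-s^2}}\,ds,\qquad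 \Delta(\xi)=\frac{2}{J(\xi)}\int_a^c\frac{\log|\overline{T(\mathrm is)}T_1(\mathrm is)|}{\sqrt{(c^2-s^2)(s^2-a^2)}}\,ds,$$ $z(\xi)=\frac12\big(12\xi(c^2-a^2)+3c^4+9a^4-6a^2c^2\big)$. Let $\mathcal R(\lambda)=\sqrt{\lambda(\lambda+c^2)(\lambda+a^2)}$, with cuts along $\sigma=[-c^2,-a^2]\cup[0,\infty)$ and positive on the upper side of $[0,\infty)$, and let $\mathbb M(\xi)$ be the elliptic Riemann surface of $\mathcal R$, with upper sheet $y=\mathcal R(\lambda)$ and lower sheet $y=-\mathcal R(\lambda)$. Put $\tau(\xi)=-\int_{-c^2}^{-a^2}\frac{d\lambda}{\mathcal R}\big(\int_{-a^2}^0\frac{d\lambda}{\mathcal R}\big)^{-1}\in\mathrm i\mathbb R_+$ (on the cut $\mathcal R$ is taken on its upper side), $\theta_3(v)=\sum_{m\in\mathbb Z}e^{\pi\mathrm i(m^2\tau+2mv)}$, and, with $\xi=\frac{x}{12t}$, $$q_{\rm RH}(x,t)=\frac{\Gamma(\xi)B'(\xi)}{6\pi}\frac{d^2}{dv^2}\log\theta_3\Big(\frac{tB(\xi)+\Delta(\xi)}{2\pi}+v\Big)\Big|_{v=0}-\frac{z'(\xi)}6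 .$$ On $\mathbb M(\xi)$ let the cycle $\mathfrak b$ surround $[-c^2,-a^2]$ clockwise on the upper sheet, and let $\mathfrak a$ run along the gap from $-a^2$ to $0$ on the lower sheet and back on the upper sheet. Let $d\omega=\tilde\Gamma\,d\lambda/\mathcal R$ with $\int_{\mathfrak a}d\omega=2\pi\mathrm i$, $\tilde\tau=\int_{\mathfrak b}d\omega$, $\theta(u)=\sum_{m\in\mathbb Z}e^{\tilde\tau m^2/2+um}$, $\mathcal K=-\frac{\tilde\tau}2+\pi\mathrm i$, $h=\int_{\mathfrak a}\frac{\lambda d\lambda}{\mathcal R}\big(\int_{\mathfrak a}\frac{d\lambda}{\mathcal R}\big)^{-1}$, $d\Omega_1=\frac{\mathrm i}2\frac{\lambda-h}{\mathcal R}d\lambda$, and $d\Omega_3=-\frac{3\mathrm i}2\frac{(\lambda-\nu_1)(\lambda-\nu_2)}{\mathcal R}d\lambda$, where $\nu_1,\nu_2\in\mathbb R$ are such that $\int_{\mathfrak a}d\Omega_3=0$ and $2\nu_1+2\nu_2+c^2+a^2=0$; let $\mathrm iV=\int_{\mathfrak b}d\Omega_1$, $\mathrm iW=\int_{\mathfrak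 b}d\Omega_3$. For $p\in\mathbb M(\xi)$ with projection in $[-a^2,0]$ let $\int_{-a^2}^{p}d\omega$ be taken along the gap (so it is defined modulo $2\pi\mathrm i$), and let $A(p)=\int_\infty^pd\omega$ be taken from $\infty$ along $(-\infty,-c^2)$ on the upper sheet, along the upper side of $[-c^2,-a^2]$, and then along the gap. **Theorem.** Let $\xi\in(-c^2/2,c^2/3)$. Then $a(\xi)$ exists and is unique, $B$ and $z$ are differentiable at $\xi$, real $\nu_1,\nu_2$ as above exist, and there is exactly one point $p_0=p_0(\xi)\in\mathbb M(\xi)$ with projection in $[-a(\xi)^2,0]$ that solves the Jacobi inversion problem $$\int_{-a(\xi)^2}^{p_0}d\omega=-\mathrm i\Delta(\xi)\pmod{2\pi\mathrm i}.$$ For all real $x$ and $t\ne0$ with $\frac{x}{12t}=\xi$, the function $q_{\rm RH}$ coincides with the one-gap Its–Matveev formula for the spectrum $[-c^2,-a(\xi)^2]\cup[0,\infty)$ and the Dirichlet divisor $p_0(\xi)$: $$q_{\rm RH}(x,t)=-2\frac{d^2}{dx^2}\log\theta\big(\mathrm iVx-4\mathrm iWt-A(p_0)-\mathcal K\big)-a(\xi)^2-c^2-2h,$$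 where $\xi$ (hence $V,W,p_0,\mathcal K,\tilde\tau$) is kept fixed in the differentiation $d^2/dx^2$, and both logarithms of theta functions are twice continuously differentiable functions of the real variable ($v$, respectively $x$). -/

import Mathlib

open MeasureTheory Filter Topology Set

noncomputable section

namespace KdVShock

/-! ### Scattering data of the steplike initial profile -/

/-- `y` solves `-y'' + q y = E y` on the line in the Carathéodory sense:
`y` is differentiable and `y'` is an integral of `(q - E) y`. -/
def IsSchrodingerSolution (q : ℝ → ℝ) (E : ℂ) (y : ℝ → ℂ) : Prop :=
  Differentiable ℝ y ∧
    ∀ x : ℝ, deriv y x = deriv y 0 + ∫ u in (0 : ℝ)..x, ((q u : ℂ) - E) * y u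

/-- Right Jost solution: `-y'' + q y = k² y` and `y(x) ~ e^{ikx}` as `x → +∞`. -/
def IsJostRight (q : ℝ → ℝ) (k : ℂ) (y : ℝ → ℂ) : Prop :=
  IsSchrodingerSolution q (k ^ 2) y ∧
    Tendsto (fun x : ℝ => Complex.exp (-(Complex.I * k * x)) * y x) atTop (𝓝 1)

/-- Left Jost solution: `-y'' + q y = (k₁² - c²) y` and `y(x) ~ e^{-ik₁x}` as `x → -∞`. -/
def IsJostLeft (c : ℝ) (q : ℝ → ℝ) (k₁ : ℂ) (y : ℝ → ℂ) : Prop :=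
  IsSchrodingerSolution q (k₁ ^ 2 - (c : ℂ) ^ 2) y ∧
    Tendsto (fun x : ℝ => Complex.exp (Complex.I * k₁ * x) * y x) atBot (𝓝 1)

/-- The right Jost solution `φ(k, ·)`. -/
def jostRight (q : ℝ → ℝ) (k : ℂ) : ℝ → ℂ :=
  Classical.epsilon (IsJostRight q k)

/-- The left Jost solution `φ₁(k, ·)`, as a function of `k₁ = √(k² + c²)`. -/
def jostLeft (c : ℝ) (q : ℝ → ℝ) (k₁ : ℂ) : ℝ → ℂ :=
  Classical.epsilon (IsJostLeft c q k₁)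

/-- The (constant) Wronskian `φ₁ φ' - φ₁' φ` of the two Jost solutions, evaluated at `x = 0`. -/
def jostWronskian (c : ℝ) (q : ℝ → ℝ) (k k₁ : ℂ) : ℂ :=
  jostLeft c q k₁ 0 * deriv (jostRight q k) 0 - deriv (jostLeft c q k₁) 0 * jostRight q k 0

/-- The transmission coefficient `T(k) = 2ik / W(k)`. -/
def transT (c : ℝ) (q : ℝ → ℝ) (k k₁ : ℂ) : ℂ :=
  2 * Complex.I * k / jostWronskian c q k k₁

/-- The transmission coefficient `T₁(k) = 2ik₁ / W(k)`, where `k₁ = √(k² + c²)`. -/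
def transT₁ (c : ℝ) (q : ℝ → ℝ) (k k₁ : ℂ) : ℂ :=
  2 * Complex.I * k₁ / jostWronskian c q k k₁

/-- `log |T̄(is) T₁(is)|` for `0 < s < c`, where `k = is` and `k₁ = √(c² - s²) > 0`. -/
def logTrans (c : ℝ) (q : ℝ → ℝ) (s : ℝ) : ℝ :=
  Real.log ‖(starRingEnd ℂ) (transT c q (Complex.I * s) (Real.sqrt (c ^ 2 - s ^ 2)))
    * transT₁ c q (Complex.I * s) (Real.sqrt (c ^ 2 - s ^ 2))‖

/-! ### The branch point parameter `a(ξ)` -/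

/-- `a ∈ (0, c)` solves the equation determining `a(ξ)`. For `0 ≤ s ≤ a` the radicand
`(s² - a²)/(c² - s²)` is non-positive; the constant factor `√(-1)`, and the sign coming from
the orientation of `∫_a^0`, do not affect the vanishing of the integral. -/
def IsBranchParam (c ξ a : ℝ) : Prop :=
  0 < a ∧ a < c ∧
    ∫ s in (0 : ℝ)..a, (ξ + (c ^ 2 - a ^ 2) / 2 - s ^ 2)
      * Real.sqrt ((a ^ 2 - s ^ 2) / (c ^ 2 - s ^ 2)) = 0

/-- The function `a(ξ)`. -/
def aFun (c ξ : ℝ) : ℝ := Classical.epsilon (IsBranchParam c ξ)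

/-! ### The elliptic surface `y² = λ(λ + c²)(λ + a²)` -/

/-- The square root on `ℂ` with cut `[0, ∞)`, positive on the upper side of the cut; on the cut
itself it takes the value of the upper side. -/
def sqrtCut (z : ℂ) : ℂ :=
  if 0 ≤ z.im then z ^ (1 / 2 : ℂ) else -z ^ (1 / 2 : ℂ)

/-- `R(λ) = √(λ(λ + c²)(λ + a²))` with cuts along `σ = [-c², -a²] ∪ [0, ∞)`, positive on the
upper side of `[0, ∞)`. For real `λ` this is the boundary value `R(λ + i0)`; it is also the value
of `R` at `λ` if `λ ∉ σ`, while `R(λ - i0) = -R(λ + i0)` on `σ`. -/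
def curveR (c a : ℝ) (l : ℂ) : ℂ :=
  sqrtCut l * sqrtCut (l + (c : ℂ) ^ 2) * sqrtCut (l + (a : ℂ) ^ 2)

/-- The finite points `(λ, y)` of the surface. The point `(λ, y)`, `λ ∉ σ`, is on the upper sheet
if `y = R(λ)`, and on the lower sheet if `y = -R(λ)`. -/
def Surface (c a : ℝ) : Type :=
  {p : ℂ × ℂ // p.2 ^ 2 = p.1 * (p.1 + (c : ℂ) ^ 2) * (p.1 + (a : ℂ) ^ 2)}

/-- The projection `π(p) = λ`. -/
def Surface.proj {c a : ℝ} (p : Surface c a) : ℂ := p.1.1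

/-- `π(p)` lies in the closed gap `[-a², 0]`. -/
def Surface.InGap {c a : ℝ} (p : Surface c a) : Prop :=
  ∃ l : ℝ, l ∈ Icc (-a ^ 2) 0 ∧ p.proj = (l : ℂ)

/-- `∫_𝔞 f(λ) dλ / y`: along the gap from `-a²` to `0` on the lower sheet, and back from `0` to
`-a²` on the upper sheet. -/
def aPeriod (c a : ℝ) (f : ℂ → ℂ) : ℂ :=
  (∫ l in (-a ^ 2)..0, f (l : ℂ) / -curveR c a l) + ∫ l in (0 : ℝ)..(-a ^ 2), f (l : ℂ) / curveR c a l

/-- `∫_𝔟 f(λ) dλ / y`, where `𝔟` surrounds `[-c², -a²]` clockwise on the upper sheet: from `-c²` to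
`-a²` along the upper side of the cut, and back along its lower side, where `y = -R(λ + i0)`. -/
def bPeriod (c a : ℝ) (f : ℂ → ℂ) : ℂ :=
  (∫ l in (-c ^ 2)..(-a ^ 2), f (l : ℂ) / curveR c a l)
    + ∫ l in (-a ^ 2)..(-c ^ 2), f (l : ℂ) / -curveR c a l

/-- The normalization constant of `dω = Γ̃ dλ / y`, so that `∫_𝔞 dω = 2πi`. -/
def normConst (c a : ℝ) : ℂ := 2 * Real.pi * Complex.I * (aPeriod c a fun _ => 1)⁻¹

/-- `τ̃ = ∫_𝔟 dω`. -/
def tauTilde (c a : ℝ) : ℂ := bPeriod c a fun _ => normConst c a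

/-- The theta function `θ(z) = ∑ exp(τ̃ m² / 2 + z m)` of the surface. -/
def theta (c a : ℝ) (z : ℂ) : ℂ :=
  ∑' m : ℤ, Complex.exp (tauTilde c a * (m : ℂ) ^ 2 / 2 + z * m)

/-- The zero `h` of `dΩ₁`. -/
def hConst (c a : ℝ) : ℂ := aPeriod c a (fun l => l) * (aPeriod c a fun _ => 1)⁻¹

/-- `dΩ₁ = dOmega₁ · dλ / y`. -/
def dOmega₁ (c a : ℝ) (l : ℂ) : ℂ := Complex.I / 2 * (l - hConst c a)

/-- `dΩ₃ = dOmega₃ · dλ / y`. -/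
def dOmega₃ (ν₁ ν₂ : ℝ) (l : ℂ) : ℂ := -(3 * Complex.I / 2) * ((l - ν₁) * (l - ν₂))

/-- The conditions on the zeros `ν₁, ν₂` of `dΩ₃`. -/
def IsNuPair (c a ν₁ ν₂ : ℝ) : Prop :=
  aPeriod c a (dOmega₃ ν₁ ν₂) = 0 ∧ 2 * ν₁ + 2 * ν₂ + c ^ 2 + a ^ 2 = 0

/-- The wave number `V`, `iV = ∫_𝔟 dΩ₁`. -/
def waveNumber (c a : ℝ) : ℂ := bPeriod c a (dOmega₁ c a) / Complex.I

/-- The frequency `W`, `iW = ∫_𝔟 dΩ₃`. -/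
def frequency (c a ν₁ ν₂ : ℝ) : ℂ := bPeriod c a (dOmega₃ ν₁ ν₂) / Complex.I

open Classical in
/-- `∫_{-a²}^p dω` for `p` over the gap, integrating along the gap on the sheet containing `p`. -/
def gapIntegral {c a : ℝ} (p : Surface c a) : ℂ :=
  if p.1.2 = curveR c a p.proj then
    ∫ l in (-a ^ 2)..p.proj.re, normConst c a / curveR c a l
  else
    ∫ l in (-a ^ 2)..p.proj.re, normConst c a / -curveR c a l

/-- The Abel map `A(p) = ∫_∞^p dω` for `p` over the gap: from `∞` to `-c²` along the negative
half-axis on the upper sheet, to `-a²` along the upper side of the cut, then inside the gap. -/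
def abelMap {c a : ℝ} (p : Surface c a) : ℂ :=
  (∫ l in Iic (-c ^ 2 : ℝ), normConst c a / curveR c a l)
    + (∫ l in (-c ^ 2)..(-a ^ 2), normConst c a / curveR c a l) + gapIntegral p

/-- The Riemann constant `𝒦 = -τ̃/2 + πi`. -/
def riemannConst (c a : ℝ) : ℂ := -tauTilde c a / 2 + Real.pi * Complex.I

/-- `log θ(iVx - 4iWt - A(p₀) - 𝒦)`. -/
def logThetaIM (c a ν₁ ν₂ : ℝ) (p₀ : Surface c a) (t x : ℝ) : ℂ :=
  Complex.log (theta c a (Complex.I * waveNumber c a * x - 4 * Complex.I * frequency c a ν₁ ν₂ * t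
    - abelMap p₀ - riemannConst c a))

/-- The one-gap solution with spectrum `[-c², -a²] ∪ [0, ∞)` and initial Dirichlet divisor `p₀`,
given by the Its–Matveev formula. -/
def qIM (c a ν₁ ν₂ : ℝ) (p₀ : Surface c a) (x t : ℝ) : ℂ :=
  -2 * iteratedDeriv 2 (logThetaIM c a ν₁ ν₂ p₀ t) x - (a : ℂ) ^ 2 - (c : ℂ) ^ 2 - 2 * hConst c a

/-! ### The Riemann–Hilbert asymptotic profile -/

/-- `∫_{-a}^{a} ds / √((c² - s²)(a² - s²))`, where `a = a(ξ)`. -/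
def gapInt (c ξ : ℝ) : ℝ :=
  ∫ s in (-aFun c ξ)..(aFun c ξ), (Real.sqrt ((c ^ 2 - s ^ 2) * (aFun c ξ ^ 2 - s ^ 2)))⁻¹

/-- `B(ξ)`. -/
def phaseB (c ξ : ℝ) : ℝ :=
  24 * ∫ s in (aFun c ξ)..c, (ξ + (c ^ 2 - aFun c ξ ^ 2) / 2 - s ^ 2)
    * Real.sqrt ((s ^ 2 - aFun c ξ ^ 2) / (c ^ 2 - s ^ 2))

/-- `Γ(ξ)`. -/
def gammaRH (c ξ : ℝ) : ℝ := -(1 / 2) * (gapInt c ξ)⁻¹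

/-- `z(ξ)`. -/
def zRH (c ξ : ℝ) : ℝ :=
  (12 * ξ * (c ^ 2 - aFun c ξ ^ 2) + 3 * c ^ 4 + 9 * aFun c ξ ^ 4 - 6 * aFun c ξ ^ 2 * c ^ 2) / 2

/-- The phase shift `Δ(ξ)`. -/
def deltaRH (c : ℝ) (q₀ : ℝ → ℝ) (ξ : ℝ) : ℝ :=
  2 * (∫ s in (aFun c ξ)..c,
      logTrans c q₀ s / Real.sqrt ((c ^ 2 - s ^ 2) * (s ^ 2 - aFun c ξ ^ 2))) * (gapInt c ξ)⁻¹

/-- `τ(ξ) ∈ iℝ₊`. -/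
def tauRH (c ξ : ℝ) : ℂ :=
  -(∫ l in (-c ^ 2)..(-aFun c ξ ^ 2), 1 / curveR c (aFun c ξ) l)
    * (∫ l in (-aFun c ξ ^ 2)..0, 1 / curveR c (aFun c ξ) l)⁻¹

/-- `log θ₃((tB(ξ) + Δ(ξ))/(2π) + v | τ(ξ))`; here
`jacobiTheta₂ v τ = ∑ exp(2πi m v + πi m² τ)`. -/
def logThetaRH (c : ℝ) (q₀ : ℝ → ℝ) (ξ t v : ℝ) : ℂ :=
  Complex.log (jacobiTheta₂
    (((t * phaseB c ξ + deltaRH c q₀ ξ) / (2 * Real.pi) + v : ℝ) : ℂ) (tauRH c ξ))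

/-- The profile `q_RH(x, t)`, with `ξ = x / (12 t)`. -/
def qRH (c : ℝ) (q₀ : ℝ → ℝ) (x t : ℝ) : ℂ :=
  ((gammaRH c (x / (12 * t)) * deriv (phaseB c) (x / (12 * t)) / (6 * Real.pi) : ℝ) : ℂ)
      * iteratedDeriv 2 (logThetaRH c q₀ (x / (12 * t)) t) 0
    - ((deriv (zRH c) (x / (12 * t)) / 6 : ℝ) : ℂ)

/-- The Jacobi inversion problem for a point over the gap `[-a(ξ)², 0]`:
`∫_{-a²}^{p₀} dω = -iΔ(ξ)`, modulo `∫_𝔞 dω = 2πi` (the path may wind around the cycle `𝔞`). -/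
def SolvesJacobi (c : ℝ) (q₀ : ℝ → ℝ) (ξ : ℝ) (p₀ : Surface c (aFun c ξ)) : Prop :=
  p₀.InGap ∧ ∃ n : ℤ,
    gapIntegral p₀ = -(Complex.I * deltaRH c q₀ ξ) + 2 * Real.pi * Complex.I * n

end KdVShock

end

/-! With m = a²/c², every quantity in both formulas is an explicit expression in the complete
elliptic integrals K = K(m), E = E(m), K' = K(1-m), E' = E(1-m). The theorem thus reduces to a few
identities among them, and Legendre's relation EK' + E'K - KK' = π/2 (`legendre_relation`) supplies
every π.

The branch equation reads ξ = c²·X(m) with X = `modX` strictly increasing from (0,1) onto (-1/2,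
1/3). This gives a(ξ) and, by inversion, its derivative. The derivative X' contains the factor 3m -
1 - 2X, a positive multiple of ∫cos⁴/Δ. The same factor occurs in ∂z/∂m and ∂B/∂m, so it cancels in
z'(ξ) and B'(ξ), leaving B' = 12πc/K and z'/6 = a² + c² + 2h (`hasDerivAt_phaseB`,
`hasDerivAt_zRH`). As V = πc/K and Γ = -c/(4K), this gives ΓB'/(6π) = -2(V/2π)² = -c²/(2K²).

The theta functions agree because τ̃ = 2πiτ (`theta_eq`). Their arguments agree modulo the period
because 12ξV - 4W = B (`phaseB_eq`), because A(p₀) + 𝒦 is 2πi plus the integral of dω from -a² to p₀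
(`abelMap_eq`), and because the Jacobi problem makes that integral -iΔ. The Jacobi problem is
uniquely solvable since the two sheets over the gap form a circle on which dω is a uniformizing
coordinate (`existsUnique_jacobi_inversion`). For imaginary τ, θ₃ is positive on ℝ, so the principal
logarithm is smooth along both arguments. -/

open MeasureTheory Filter Topology Set

noncomputable section

namespace KdVShock

/-! ### Complete elliptic integrals -/

/-- Differentiation under the integral sign for a jointly continuous derivative. -/
lemma hasDerivAt_integral_of_continuousOn {F F' : ℝ → ℝ → ℝ} {U : Set ℝ} (hU : IsOpen U)
    {a b x₀ : ℝ} (hx₀ : x₀ ∈ U) (hF : ∀ x ∈ U, Continuous (F x))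
    (hF' : ContinuousOn (Function.uncurry F') (U ×ˢ univ))
    (hd : ∀ x ∈ U, ∀ t, HasDerivAt (fun y => F y t) (F' x t) x) :
    HasDerivAt (fun x => ∫ t in a..b, F x t) (∫ t in a..b, F' x₀ t) x₀ := by
  obtain ⟨ε, hε, hball⟩ := Metric.nhds_basis_closedBall.mem_iff.1 (hU.mem_nhds hx₀)
  have hK : IsCompact (Metric.closedBall x₀ ε ×ˢ uIcc a b) :=
    (isCompact_closedBall x₀ ε).prod isCompact_uIcc
  obtain ⟨M, hM⟩ := hK.exists_bound_of_continuousOn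
    (hF'.mono (prod_mono hball (subset_univ _)))
  have hs : Metric.closedBall x₀ ε ∈ 𝓝 x₀ := Metric.closedBall_mem_nhds x₀ hε
  refine (intervalIntegral.hasDerivAt_integral_of_dominated_loc_of_deriv_le (bound := fun _ => M)
    hs ?_ ?_ ?_ ?_ ?_ ?_).2
  · filter_upwards [hs] with x hx
    exact (hF x (hball hx)).aestronglyMeasurable
  · exact (hF x₀ hx₀).intervalIntegrable _ _
  · have : Continuous (F' x₀) := by
      have h2 : ContinuousOn (fun t : ℝ => Function.uncurry F' (x₀, t)) univ :=
        hF'.comp (by fun_prop) (fun t _ => ⟨hx₀, mem_univ _⟩)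
      simpa [continuousOn_univ, Function.uncurry] using h2
    exact this.aestronglyMeasurable
  · refine Eventually.of_forall fun t ht x hx => ?_
    exact hM (x, t) ⟨hx, uIoc_subset_uIcc ht⟩
  · exact intervalIntegrable_const
  · exact Eventually.of_forall fun t _ x hx => hd x (hball hx) t

/-- The Legendre modular factor `√(1 - m sin² φ)`. -/
def ellDelta (m φ : ℝ) : ℝ := Real.sqrt (1 - m * Real.sin φ ^ 2)

/-- The complete elliptic integral of the first kind, as a function of the parameter `m`. -/
def ellK (m : ℝ) : ℝ := ∫ φ in (0 : ℝ)..(Real.pi / 2), (ellDelta m φ)⁻¹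

/-- The complete elliptic integral of the second kind, as a function of the parameter `m`. -/
def ellE (m : ℝ) : ℝ := ∫ φ in (0 : ℝ)..(Real.pi / 2), ellDelta m φ

lemma one_sub_mul_sin_sq_pos {m : ℝ} (hm : m < 1) (φ : ℝ) : 0 < 1 - m * Real.sin φ ^ 2 := by
  have h1 := Real.sin_sq_le_one φ
  have h2 := sq_nonneg (Real.sin φ)
  rcases h2.eq_or_lt with h | h
  · rw [← h]; norm_num
  · nlinarith

lemma ellDelta_pos {m : ℝ} (hm : m < 1) (φ : ℝ) : 0 < ellDelta m φ :=
  Real.sqrt_pos.2 (one_sub_mul_sin_sq_pos hm φ)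

lemma ellDelta_sq {m : ℝ} (hm : m < 1) (φ : ℝ) : ellDelta m φ ^ 2 = 1 - m * Real.sin φ ^ 2 :=
  Real.sq_sqrt (one_sub_mul_sin_sq_pos hm φ).le

lemma continuous_ellDelta (m : ℝ) : Continuous (ellDelta m) := by
  unfold ellDelta; fun_prop

lemma continuous_div_ellDelta {m : ℝ} (hm : m < 1) {g : ℝ → ℝ} (hg : Continuous g) :
    Continuous fun φ => g φ / ellDelta m φ :=
  hg.div (continuous_ellDelta m) fun φ => (ellDelta_pos hm φ).ne'

lemma hasDerivAt_ellDelta_param {m : ℝ} (hm : m < 1) (φ : ℝ) :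
    HasDerivAt (fun m => ellDelta m φ) (-Real.sin φ ^ 2 / (2 * ellDelta m φ)) m := by
  have h : HasDerivAt (fun m : ℝ => 1 - m * Real.sin φ ^ 2) (-Real.sin φ ^ 2) m := by
    simpa using ((hasDerivAt_id m).mul_const (Real.sin φ ^ 2)).const_sub 1
  exact h.sqrt (one_sub_mul_sin_sq_pos hm φ).ne'

lemma hasDerivAt_ellDelta_angle {m : ℝ} (hm : m < 1) (φ : ℝ) :
    HasDerivAt (ellDelta m) (-(m * Real.sin φ * Real.cos φ) / ellDelta m φ) φ := by
  have h : HasDerivAt (fun φ : ℝ => 1 - m * Real.sin φ ^ 2)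
      (-(m * (2 * Real.sin φ * Real.cos φ))) φ := by
    simpa using (((Real.hasDerivAt_sin φ).pow 2).const_mul m).const_sub 1
  refine (h.sqrt (one_sub_mul_sin_sq_pos hm φ).ne').congr_deriv ?_
  have := (ellDelta_pos hm φ).ne'
  change _ / (2 * ellDelta m φ) = _
  field_simp

lemma continuousOn_ellDelta_uncurry :
    ContinuousOn (fun p : ℝ × ℝ => ellDelta p.1 p.2) (Iio 1 ×ˢ univ) := by
  unfold ellDelta; fun_prop

lemma hasDerivAt_ellE_aux {m : ℝ} (hm : m < 1) :
    HasDerivAt ellE (∫ φ in (0 : ℝ)..(Real.pi / 2), -Real.sin φ ^ 2 / (2 * ellDelta m φ)) m := by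
  refine hasDerivAt_integral_of_continuousOn (F := ellDelta)
    (F' := fun m φ => -Real.sin φ ^ 2 / (2 * ellDelta m φ)) isOpen_Iio hm
    (fun x _ => continuous_ellDelta x) ?_ (fun x hx t => hasDerivAt_ellDelta_param hx t)
  refine ContinuousOn.div (by fun_prop) (continuousOn_const.mul continuousOn_ellDelta_uncurry) ?_
  rintro ⟨x, t⟩ ⟨hx, -⟩
  exact (mul_pos two_pos (ellDelta_pos hx t)).ne'

/-- The unevaluated form also covers m = 0, where the closed form divides by zero; Legendre's
relation needs the continuity of K there. -/
lemma hasDerivAt_ellK_aux {m : ℝ} (hm : m < 1) :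
    HasDerivAt ellK (∫ φ in (0 : ℝ)..(Real.pi / 2), Real.sin φ ^ 2 / (2 * ellDelta m φ ^ 3)) m := by
  refine hasDerivAt_integral_of_continuousOn (F := fun m φ => (ellDelta m φ)⁻¹)
    (F' := fun m φ => Real.sin φ ^ 2 / (2 * ellDelta m φ ^ 3)) isOpen_Iio hm
    (fun x hx => (continuous_ellDelta x).inv₀ fun φ => (ellDelta_pos hx φ).ne') ?_ ?_
  · refine ContinuousOn.div (by fun_prop)
      (continuousOn_const.mul (continuousOn_ellDelta_uncurry.pow 3)) ?_
    rintro ⟨x, t⟩ ⟨hx, -⟩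
    exact (mul_pos two_pos (pow_pos (ellDelta_pos hx t) 3)).ne'
  · intro x hx t
    have h0 := (ellDelta_pos hx t).ne'
    refine ((hasDerivAt_ellDelta_param hx t).inv h0).congr_deriv ?_
    field_simp

/-- The second moment `∫ sin² / Δ`. -/
lemma integral_sin_sq_div_ellDelta {m : ℝ} (hm : m < 1) :
    m * ∫ φ in (0 : ℝ)..(Real.pi / 2), Real.sin φ ^ 2 / ellDelta m φ = ellK m - ellE m := by
  unfold ellK ellE
  rw [← intervalIntegral.integral_sub, ← intervalIntegral.integral_const_mul]
  · refine intervalIntegral.integral_congr fun φ _ => ?_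
    have h0 := (ellDelta_pos hm φ).ne'
    have h1 := ellDelta_sq hm φ
    field_simp
    linear_combination h1
  · exact ((continuous_ellDelta m).inv₀ fun φ => (ellDelta_pos hm φ).ne').intervalIntegrable _ _
  · exact (continuous_ellDelta m).intervalIntegrable _ _

/-- The fourth moment `∫ sin⁴ / Δ`. -/
lemma integral_sin_pow_four_div_ellDelta {m : ℝ} (hm : m < 1) :
    3 * m ^ 2 * ∫ φ in (0 : ℝ)..(Real.pi / 2), Real.sin φ ^ 4 / ellDelta m φ
      = 2 * (1 + m) * (ellK m - ellE m) - m * ellK m := by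
  -- The primitive sin·cos·Δ vanishes at 0 and π/2, so the integral of its derivative is a linear
  -- relation between the moments of order 0, 2 and 4.
  have hder : ∀ φ ∈ uIcc 0 (Real.pi / 2), HasDerivAt
      (fun φ => Real.sin φ * Real.cos φ * ellDelta m φ)
      ((ellDelta m φ)⁻¹ - 2 * (1 + m) * (Real.sin φ ^ 2 / ellDelta m φ)
        + 3 * m * (Real.sin φ ^ 4 / ellDelta m φ)) φ := by
    intro φ _
    refine (((Real.hasDerivAt_sin φ).mul (Real.hasDerivAt_cos φ)).mul
      (hasDerivAt_ellDelta_angle hm φ)).congr_deriv ?_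
    have h0 := (ellDelta_pos hm φ).ne'
    have h1 := ellDelta_sq hm φ
    have h2 := Real.cos_sq' φ
    simp only [Pi.mul_apply]
    field_simp
    rw [h1, h2]
    ring
  have i0 : IntervalIntegrable (fun φ => (ellDelta m φ)⁻¹) volume 0 (Real.pi / 2) :=
    ((continuous_ellDelta m).inv₀ fun φ => (ellDelta_pos hm φ).ne').intervalIntegrable _ _
  have i1 : IntervalIntegrable (fun φ => 2 * (1 + m) * (Real.sin φ ^ 2 / ellDelta m φ))
      volume 0 (Real.pi / 2) :=
    (continuous_const.mul (continuous_div_ellDelta hm (by fun_prop))).intervalIntegrable _ _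
  have i2 : IntervalIntegrable (fun φ => 3 * m * (Real.sin φ ^ 4 / ellDelta m φ))
      volume 0 (Real.pi / 2) :=
    (continuous_const.mul (continuous_div_ellDelta hm (by fun_prop))).intervalIntegrable _ _
  have key := intervalIntegral.integral_eq_sub_of_hasDerivAt hder ((i0.sub i1).add i2)
  rw [intervalIntegral.integral_add (i0.sub i1) i2, intervalIntegral.integral_sub i0 i1,
    intervalIntegral.integral_const_mul, intervalIntegral.integral_const_mul] at key
  simp only [Real.sin_zero, Real.cos_pi_div_two] at key
  have h2 := integral_sin_sq_div_ellDelta hm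
  change ellK m - _ + _ = _ at key
  linear_combination m * key + 2 * (1 + m) * h2

/-- `∫ Δ⁻³ = E / (1 - m)`. -/
lemma integral_inv_ellDelta_cube {m : ℝ} (hm : m < 1) :
    (1 - m) * ∫ φ in (0 : ℝ)..(Real.pi / 2), (ellDelta m φ ^ 3)⁻¹ = ellE m := by
  -- Again a primitive that vanishes at both endpoints, now trading Δ⁻³ for Δ.
  have hder : ∀ φ ∈ uIcc 0 (Real.pi / 2), HasDerivAt
      (fun φ => m * (Real.sin φ * Real.cos φ / ellDelta m φ))
      (ellDelta m φ - (1 - m) * (ellDelta m φ ^ 3)⁻¹) φ := by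
    intro φ _
    have h0 := (ellDelta_pos hm φ).ne'
    refine ((((Real.hasDerivAt_sin φ).mul (Real.hasDerivAt_cos φ)).div
      (hasDerivAt_ellDelta_angle hm φ) h0).const_mul m).congr_deriv ?_
    have h1 := ellDelta_sq hm φ
    have h2 := Real.cos_sq' φ
    have h3 : ellDelta m φ ^ 4 = (1 - m * Real.sin φ ^ 2) ^ 2 := by rw [← h1]; ring
    simp only [Pi.mul_apply]
    field_simp
    rw [h1, h2, h3]
    ring
  have i0 : IntervalIntegrable (ellDelta m) volume 0 (Real.pi / 2) :=
    (continuous_ellDelta m).intervalIntegrable _ _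
  have i1 : IntervalIntegrable (fun φ => (1 - m) * (ellDelta m φ ^ 3)⁻¹) volume 0 (Real.pi / 2) :=
    (continuous_const.mul (((continuous_ellDelta m).pow 3).inv₀
      fun φ => (pow_pos (ellDelta_pos hm φ) 3).ne')).intervalIntegrable _ _
  have key := intervalIntegral.integral_eq_sub_of_hasDerivAt hder (i0.sub i1)
  rw [intervalIntegral.integral_sub i0 i1, intervalIntegral.integral_const_mul] at key
  simp only [Real.sin_zero, Real.cos_pi_div_two] at key
  change ellE m - _ = _ at key
  linear_combination -key

lemma hasDerivAt_ellE {m : ℝ} (h0 : 0 < m) (hm : m < 1) :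
    HasDerivAt ellE ((ellE m - ellK m) / (2 * m)) m := by
  refine (hasDerivAt_ellE_aux hm).congr_deriv ?_
  have h : ∀ φ, -Real.sin φ ^ 2 / (2 * ellDelta m φ)
      = (-1 / 2) * (Real.sin φ ^ 2 / ellDelta m φ) := by intro φ; ring
  simp_rw [h, intervalIntegral.integral_const_mul]
  have := integral_sin_sq_div_ellDelta hm
  field_simp
  linear_combination -this

lemma hasDerivAt_ellK {m : ℝ} (h0 : 0 < m) (hm : m < 1) :
    HasDerivAt ellK ((ellE m - (1 - m) * ellK m) / (2 * m * (1 - m))) m := by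
  refine (hasDerivAt_ellK_aux hm).congr_deriv ?_
  have h : ∀ φ, Real.sin φ ^ 2 / (2 * ellDelta m φ ^ 3)
      = (1 / (2 * m)) * ((ellDelta m φ ^ 3)⁻¹ - (ellDelta m φ)⁻¹) := by
    intro φ
    have h2 := (ellDelta_pos hm φ).ne'
    have h1 := ellDelta_sq hm φ
    field_simp
    linear_combination h1
  simp_rw [h, intervalIntegral.integral_const_mul]
  rw [intervalIntegral.integral_sub]
  · have := integral_inv_ellDelta_cube hm
    change 1 / (2 * m) * (_ - ellK m) = _
    have h1m : 1 - m ≠ 0 := by linarith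
    rw [← this]
    generalize (∫ φ in (0 : ℝ)..(Real.pi / 2), (ellDelta m φ ^ 3)⁻¹) = U
    field_simp
  · exact (((continuous_ellDelta m).pow 3).inv₀
      fun φ => (pow_pos (ellDelta_pos hm φ) 3).ne').intervalIntegrable _ _
  · exact ((continuous_ellDelta m).inv₀ fun φ => (ellDelta_pos hm φ).ne').intervalIntegrable _ _

/-! ### Positivity, boundary values and bounds for K and E -/

lemma ellK_pos {m : ℝ} (hm : m < 1) : 0 < ellK m := by
  refine intervalIntegral.intervalIntegral_pos_of_pos_on
    (((continuous_ellDelta m).inv₀ fun φ => (ellDelta_pos hm φ).ne').intervalIntegrable _ _)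
    (fun φ _ => inv_pos.2 (ellDelta_pos hm φ)) (by positivity)

lemma ellK_zero : ellK 0 = Real.pi / 2 := by simp [ellK, ellDelta]

lemma ellE_one : ellE 1 = 1 := by
  have h : ∀ φ ∈ uIcc 0 (Real.pi / 2), ellDelta 1 φ = Real.cos φ := by
    intro φ hφ
    rw [uIcc_of_le (by positivity)] at hφ
    rw [ellDelta, one_mul, ← Real.cos_sq', Real.sqrt_sq]
    exact Real.cos_nonneg_of_mem_Icc ⟨by linarith [hφ.1, Real.pi_pos], hφ.2⟩
  rw [ellE, intervalIntegral.integral_congr h, integral_cos]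
  simp

lemma continuous_ellE : Continuous ellE := by
  unfold ellE ellDelta
  exact intervalIntegral.continuous_parametric_intervalIntegral_of_continuous' (by fun_prop) _ _

/-- From Δ ≥ √(1-m). Crude, but it makes (1-m)K of order √(1-m) as m → 1, which suffices both for
Legendre's relation and for the range of `modX`. -/
lemma ellK_le {m : ℝ} (h0 : 0 ≤ m) (hm : m < 1) : ellK m ≤ Real.pi / 2 / Real.sqrt (1 - m) := by
  have h1 : 0 < Real.sqrt (1 - m) := Real.sqrt_pos.2 (by linarith)
  have : ellK m ≤ ∫ φ in (0 : ℝ)..(Real.pi / 2), (Real.sqrt (1 - m))⁻¹ := by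
    refine intervalIntegral.integral_mono_on (by positivity)
      (((continuous_ellDelta m).inv₀ fun φ => (ellDelta_pos hm φ).ne').intervalIntegrable _ _)
      intervalIntegrable_const fun φ _ => ?_
    refine inv_anti₀ h1 (Real.sqrt_le_sqrt ?_)
    nlinarith [Real.sin_sq_le_one φ]
  simpa [div_eq_mul_inv] using this

/-- `E - (1 - m) K = m ∫ cos² / Δ`. -/
lemma ellE_sub_eq {m : ℝ} (hm : m < 1) :
    ellE m - (1 - m) * ellK m
      = m * ∫ φ in (0 : ℝ)..(Real.pi / 2), Real.cos φ ^ 2 / ellDelta m φ := by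
  have h : ∀ φ, Real.cos φ ^ 2 / ellDelta m φ
      = (ellDelta m φ)⁻¹ - Real.sin φ ^ 2 / ellDelta m φ := by
    intro φ; rw [Real.cos_sq']; ring
  simp_rw [h]
  rw [intervalIntegral.integral_sub, mul_sub, integral_sin_sq_div_ellDelta hm]
  · change _ = m * ellK m - _
    ring
  · exact ((continuous_ellDelta m).inv₀ fun φ => (ellDelta_pos hm φ).ne').intervalIntegrable _ _
  · exact (continuous_div_ellDelta hm (by fun_prop)).intervalIntegrable _ _

/-- Since Δ ≤ 1, the integral ∫cos²/Δ is at least ∫cos² = π/4. -/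
lemma ellE_sub_ge {m : ℝ} (h0 : 0 < m) (hm : m < 1) :
    m * (Real.pi / 4) ≤ ellE m - (1 - m) * ellK m := by
  rw [ellE_sub_eq hm]
  refine mul_le_mul_of_nonneg_left ?_ h0.le
  have h : (∫ φ in (0 : ℝ)..(Real.pi / 2), Real.cos φ ^ 2) = Real.pi / 4 := by
    rw [integral_cos_sq]; simp; ring
  rw [← h]
  refine intervalIntegral.integral_mono_on (by positivity)
    (Continuous.intervalIntegrable (by fun_prop) _ _)
    ((continuous_div_ellDelta hm (by fun_prop)).intervalIntegrable _ _) fun φ _ => ?_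
  rw [le_div_iff₀ (ellDelta_pos hm φ)]
  refine mul_le_of_le_one_right (sq_nonneg _) ?_
  rw [ellDelta, Real.sqrt_le_one]
  nlinarith [sq_nonneg (Real.sin φ)]

lemma ellE_sub_pos {m : ℝ} (h0 : 0 < m) (hm : m < 1) : 0 < ellE m - (1 - m) * ellK m :=
  lt_of_lt_of_le (by positivity) (ellE_sub_ge h0 hm)

/-- Even trigonometric polynomials of degree four over `Δ`. -/
lemma integral_quartic_div_ellDelta {m : ℝ} (h0 : 0 < m) (hm : m < 1) (p₀ p₁ p₂ : ℝ) :
    (∫ φ in (0 : ℝ)..(Real.pi / 2),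
        (p₀ + p₁ * Real.sin φ ^ 2 + p₂ * Real.sin φ ^ 4) / ellDelta m φ)
      = p₀ * ellK m + p₁ * ((ellK m - ellE m) / m)
        + p₂ * ((2 * (1 + m) * (ellK m - ellE m) - m * ellK m) / (3 * m ^ 2)) := by
  have h : ∀ φ, (p₀ + p₁ * Real.sin φ ^ 2 + p₂ * Real.sin φ ^ 4) / ellDelta m φ
      = p₀ * (ellDelta m φ)⁻¹ + p₁ * (Real.sin φ ^ 2 / ellDelta m φ)
        + p₂ * (Real.sin φ ^ 4 / ellDelta m φ) := by intro φ; ring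
  have i0 : IntervalIntegrable (fun φ => p₀ * (ellDelta m φ)⁻¹) volume 0 (Real.pi / 2) :=
    (continuous_const.mul ((continuous_ellDelta m).inv₀
      fun φ => (ellDelta_pos hm φ).ne')).intervalIntegrable _ _
  have i1 : IntervalIntegrable (fun φ => p₁ * (Real.sin φ ^ 2 / ellDelta m φ))
      volume 0 (Real.pi / 2) :=
    (continuous_const.mul (continuous_div_ellDelta hm (by fun_prop))).intervalIntegrable _ _
  have i2 : IntervalIntegrable (fun φ => p₂ * (Real.sin φ ^ 4 / ellDelta m φ))
      volume 0 (Real.pi / 2) :=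
    (continuous_const.mul (continuous_div_ellDelta hm (by fun_prop))).intervalIntegrable _ _
  simp_rw [h]
  rw [intervalIntegral.integral_add (i0.add i1) i2, intervalIntegral.integral_add i0 i1,
    intervalIntegral.integral_const_mul, intervalIntegral.integral_const_mul,
    intervalIntegral.integral_const_mul, ← integral_sin_sq_div_ellDelta hm,
    ← mul_div_cancel_left₀ (∫ φ in (0 : ℝ)..(Real.pi / 2), Real.sin φ ^ 4 / ellDelta m φ)
      (show 3 * m ^ 2 ≠ 0 by positivity), integral_sin_pow_four_div_ellDelta hm,
    mul_div_cancel_left₀ _ h0.ne', integral_sin_sq_div_ellDelta hm]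
  rfl

/-- Positivity of `3 m² ∫ cos⁴ / Δ`. -/
lemma ell_cos_pow_four_pos {m : ℝ} (h0 : 0 < m) (hm : m < 1) :
    0 < (1 - m) * (2 - 3 * m) * ellK m + (4 * m - 2) * ellE m := by
  have hpos : 0 < ∫ φ in (0 : ℝ)..(Real.pi / 2), Real.cos φ ^ 4 / ellDelta m φ := by
    refine intervalIntegral.intervalIntegral_pos_of_pos_on
      ((continuous_div_ellDelta hm (by fun_prop)).intervalIntegrable _ _)
      (fun φ hφ => div_pos (pow_pos (Real.cos_pos_of_mem_Ioo
        ⟨by linarith [hφ.1, Real.pi_pos], hφ.2⟩) 4) (ellDelta_pos hm φ)) (by positivity)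
  have h : ∀ φ, Real.cos φ ^ 4 / ellDelta m φ
      = (1 + -2 * Real.sin φ ^ 2 + 1 * Real.sin φ ^ 4) / ellDelta m φ := by
    intro φ
    rw [show Real.cos φ ^ 4 = (Real.cos φ ^ 2) ^ 2 by ring, Real.cos_sq']; ring
  simp_rw [h] at hpos
  rw [integral_quartic_div_ellDelta h0 hm] at hpos
  have := mul_pos (show 0 < 3 * m ^ 2 by positivity) hpos
  field_simp at this
  linarith

/-- Legendre's relation. -/
theorem legendre_relation {m : ℝ} (h0 : 0 < m) (hm : m < 1) :
    ellE (1 - m) * ellK m + ellE m * ellK (1 - m) - ellK m * ellK (1 - m) = Real.pi / 2 := by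
  -- Grouped so that K(1-m), which blows up as m → 0, multiplies K - E, which vanishes there. L has
  -- derivative zero, and its value is read off at 0⁺.
  set L : ℝ → ℝ := fun m =>
    ellE (1 - m) * ellK m - (ellK m - ellE m) * ellK (1 - m) with hL
  have hd : ∀ x ∈ Ioo (0 : ℝ) 1, HasDerivAt L 0 x := by
    intro x hx
    have hx' : HasDerivAt (fun x : ℝ => 1 - x) (-1) x := by
      simpa using (hasDerivAt_id x).const_sub 1
    have hE' := (hasDerivAt_ellE (m := 1 - x) (by linarith [hx.2]) (by linarith [hx.1])).comp x hx'
    have hK' := (hasDerivAt_ellK (m := 1 - x) (by linarith [hx.2]) (by linarith [hx.1])).comp x hx'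
    have hE := hasDerivAt_ellE hx.1 hx.2
    have hK := hasDerivAt_ellK hx.1 hx.2
    refine ((hE'.mul hK).sub ((hK.sub hE).mul hK')).congr_deriv ?_
    have h1 : x ≠ 0 := hx.1.ne'
    have h2 : 1 - x ≠ 0 := by linarith [hx.2]
    simp only [Function.comp, sub_sub_cancel, Pi.sub_apply]
    field_simp
    ring
  have hconst : ∀ x ∈ Ioo (0 : ℝ) 1, L x = L m := fun x hx =>
    (convex_Ioo (0 : ℝ) 1).is_const_of_fderivWithin_eq_zero
      (fun y hy => (hd y hy).differentiableAt.differentiableWithinAt)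
      (fun y hy => by
        rw [fderivWithin_of_isOpen isOpen_Ioo hy]
        ext; simp [(hd y hy).deriv]) hx ⟨h0, hm⟩
  have hKc : ContinuousAt ellK 0 := (hasDerivAt_ellK_aux zero_lt_one).continuousAt
  have lim1 : Tendsto (fun x => ellE (1 - x) * ellK x) (𝓝[>] 0) (𝓝 (Real.pi / 2)) := by
    have h1 : ContinuousAt (fun x : ℝ => ellE (1 - x) * ellK x) 0 :=
      (continuous_ellE.comp (by fun_prop)).continuousAt.mul hKc
    have := h1.tendsto.mono_left (nhdsWithin_le_nhds (s := Ioi 0))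
    simpa [ellE_one, ellK_zero] using this
  -- Here K - E ≤ xK and K(1-x) ≤ (π/2)/√x, so the product is O(√x).
  have lim2 : Tendsto (fun x => (ellK x - ellE x) * ellK (1 - x)) (𝓝[>] 0) (𝓝 0) := by
    have hub : Tendsto (fun x : ℝ => x / Real.sqrt x * (Real.pi / 2) *
        (ellK x)) (𝓝[>] 0) (𝓝 0) := by
      have h1 : ContinuousAt (fun x : ℝ => Real.sqrt x * (Real.pi / 2) * ellK x) 0 :=
        (Continuous.continuousAt (by fun_prop)).mul hKc
      have := h1.tendsto.mono_left (nhdsWithin_le_nhds (s := Ioi 0))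
      simp only [Real.sqrt_zero, zero_mul] at this
      simpa [Real.div_sqrt] using this
    have hmem : ∀ᶠ x in 𝓝[>] (0 : ℝ), x ∈ Ioo (0 : ℝ) 1 := Ioo_mem_nhdsGT zero_lt_one
    refine tendsto_of_tendsto_of_tendsto_of_le_of_le' tendsto_const_nhds hub ?_ ?_
    · filter_upwards [hmem] with x hx
      refine mul_nonneg ?_ (ellK_pos (by linarith [hx.1])).le
      rw [← integral_sin_sq_div_ellDelta hx.2]
      exact mul_nonneg hx.1.le (intervalIntegral.integral_nonneg (by positivity)
        fun φ _ => div_nonneg (sq_nonneg _) (ellDelta_pos hx.2 φ).le)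
    · filter_upwards [hmem] with x hx
      have h1 : ellK x - ellE x ≤ x * ellK x := by linarith [ellE_sub_pos hx.1 hx.2]
      have h2 := ellK_le (m := 1 - x) (by linarith [hx.2]) (by linarith [hx.1])
      rw [sub_sub_cancel] at h2
      have h3 := ellK_pos hx.2
      calc (ellK x - ellE x) * ellK (1 - x) ≤ (x * ellK x) * (Real.pi / 2 / Real.sqrt x) :=
            mul_le_mul h1 h2 (ellK_pos (by linarith [hx.1])).le (mul_nonneg hx.1.le h3.le)
        _ = _ := by ring
  have lim : Tendsto L (𝓝[>] 0) (𝓝 (Real.pi / 2)) := by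
    simpa [hL] using lim1.sub lim2
  have lim' : Tendsto L (𝓝[>] 0) (𝓝 (L m)) := by
    refine tendsto_const_nhds.congr' ?_
    filter_upwards [Ioo_mem_nhdsGT (zero_lt_one' ℝ)] with x hx using (hconst x hx).symm
  have := tendsto_nhds_unique lim' lim
  simp only [hL] at this
  linear_combination this

/-! ### The modulation equation in terms of elliptic integrals -/

/-- The value of `ξ / c²` for which `a(ξ)² / c² = m`. -/
def modX (m : ℝ) : ℝ := (1 + m) / 6 - m * (1 - m) * ellK m / (3 * (ellE m - (1 - m) * ellK m))

/-- The quantity is a positive multiple of ∫cos⁴/Δ. It governs the sign of the derivative of `modX`,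
and also bounds `modX` above by a function tending to -1/2 as m → 0. -/
lemma modX_gap_pos {m : ℝ} (h0 : 0 < m) (hm : m < 1) : 0 < 3 * m - 1 - 2 * modX m := by
  have hD := ellE_sub_pos h0 hm
  have h := ell_cos_pow_four_pos h0 hm
  have : 3 * m - 1 - 2 * modX m = 2 * ((1 - m) * (2 - 3 * m) * ellK m + (4 * m - 2) * ellE m)
      / (3 * (ellE m - (1 - m) * ellK m)) := by
    rw [modX]; field_simp; ring
  rw [this]; positivity

/-- Written through `modX m` itself to display the factor 3m - 1 - 2X, which is positive and later
cancels in z' and B'. -/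
lemma hasDerivAt_modX {m : ℝ} (h0 : 0 < m) (hm : m < 1) :
    HasDerivAt modX (ellK m * (3 * m - 1 - 2 * modX m) / (4 * (ellE m - (1 - m) * ellK m))) m := by
  have hD := (ellE_sub_pos h0 hm).ne'
  have hE := hasDerivAt_ellE h0 hm
  have hK := hasDerivAt_ellK h0 hm
  have h1 : HasDerivAt (fun m : ℝ => 1 - m) (-1) m := by
    simpa using (hasDerivAt_id m).const_sub 1
  have hid := hasDerivAt_id m
  have hnum := (hid.mul h1).mul hK
  have hden := (hE.sub (h1.mul hK)).const_mul 3
  refine (((hid.const_add 1).div_const 6).sub (hnum.div hden (by simpa using hD))).congr_deriv ?_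
  have h2 : 1 - m ≠ 0 := by linarith
  simp only [modX, Pi.mul_apply, Pi.sub_apply, id]
  field_simp
  ring

lemma strictMonoOn_modX : StrictMonoOn modX (Ioo 0 1) := by
  refine strictMonoOn_of_deriv_pos (convex_Ioo 0 1)
    (fun m hm => (hasDerivAt_modX hm.1 hm.2).continuousAt.continuousWithinAt) fun m hm => ?_
  rw [interior_Ioo] at hm
  rw [(hasDerivAt_modX hm.1 hm.2).deriv]
  have := ellE_sub_pos hm.1 hm.2
  have := ellK_pos hm.2
  have := modX_gap_pos hm.1 hm.2
  positivity

lemma modX_le {m : ℝ} (h0 : 0 < m) (hm : m < 1) : modX m ≤ (3 * m - 1) / 2 := by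
  linarith [modX_gap_pos h0 hm]

/-- `ellK_le` bounds the numerator of the subtracted term and `ellE_sub_ge` its denominator. The
lower bound tends to 1/3 as m → 1. -/
lemma modX_ge {m : ℝ} (h0 : 0 < m) (hm : m < 1) :
    (1 + m) / 6 - 2 / 3 * Real.sqrt (1 - m) ≤ modX m := by
  have hD := ellE_sub_ge h0 hm
  have hD' := ellE_sub_pos h0 hm
  have hK := ellK_le h0.le hm
  have hs : 0 < Real.sqrt (1 - m) := Real.sqrt_pos.2 (by linarith)
  have hs2 : Real.sqrt (1 - m) ^ 2 = 1 - m := Real.sq_sqrt (by linarith)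
  have hK' : (1 - m) * ellK m ≤ Real.pi / 2 * Real.sqrt (1 - m) := by
    rw [le_div_iff₀ hs] at hK
    calc (1 - m) * ellK m = Real.sqrt (1 - m) * (ellK m * Real.sqrt (1 - m)) := by
          linear_combination -ellK m * hs2
      _ ≤ Real.sqrt (1 - m) * (Real.pi / 2) := by gcongr
      _ = _ := by ring
  have : m * (1 - m) * ellK m / (3 * (ellE m - (1 - m) * ellK m)) ≤ 2 / 3 * Real.sqrt (1 - m) := by
    rw [div_le_iff₀ (by positivity)]
    calc m * (1 - m) * ellK m = m * ((1 - m) * ellK m) := by ring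
      _ ≤ m * (Real.pi / 2 * Real.sqrt (1 - m)) := by gcongr
      _ = 2 * Real.sqrt (1 - m) * (m * (Real.pi / 4)) := by ring
      _ ≤ 2 * Real.sqrt (1 - m) * (ellE m - (1 - m) * ellK m) := by gcongr
      _ = _ := by ring
  rw [modX]; linarith

lemma exists_modX_eq {x : ℝ} (hx : x ∈ Ioo (-1 / 2 : ℝ) (1 / 3)) : ∃ m ∈ Ioo (0 : ℝ) 1, modX m = x := by
  obtain ⟨m₁, h₁, h₁x⟩ : ∃ m ∈ Ioo (0 : ℝ) 1, modX m ≤ x := by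
    -- By `modX_le` any m ≤ (2x+1)/3 will do; (2x+1)/4 is such an m and lies in (0,1).
    refine ⟨(x + 1 / 2) / 2, ⟨by linarith [hx.1], by linarith [hx.2]⟩, ?_⟩
    refine (modX_le (by linarith [hx.1]) (by linarith [hx.2])).trans ?_
    linarith [hx.1]
  obtain ⟨m₂, h₂, h₂x⟩ : ∃ m ∈ Ioo (0 : ℝ) 1, x ≤ modX m := by
    have hc : Tendsto (fun m : ℝ => (1 + m) / 6 - 2 / 3 * Real.sqrt (1 - m)) (𝓝[<] 1)
        (𝓝 (1 / 3)) := by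
      have h : Continuous (fun m : ℝ => (1 + m) / 6 - 2 / 3 * Real.sqrt (1 - m)) := by fun_prop
      have := (h.tendsto 1).mono_left (nhdsWithin_le_nhds (s := Iio 1))
      norm_num at this
      convert this using 2
    have h3 := (hc.eventually (lt_mem_nhds hx.2)).and (Ioo_mem_nhdsLT (zero_lt_one' ℝ))
    obtain ⟨m, hm, hm'⟩ := h3.exists
    exact ⟨m, hm', hm.le.trans (modX_ge hm'.1 hm'.2)⟩
  have hc : ContinuousOn modX (Ioo 0 1) := fun m hm =>
    (hasDerivAt_modX hm.1 hm.2).continuousAt.continuousWithinAt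
  exact isPreconnected_Ioo.intermediate_value h₁ h₂ hc ⟨h₁x, h₂x⟩

/-! ### Substitutions -/

/-- Change of variables along an increasing map, without integrability assumptions. -/
lemma integral_comp_of_deriv_pos {f f' : ℝ → ℝ} {a b : ℝ} (hab : a ≤ b)
    (hf : ContinuousOn f (Icc a b)) (hd : ∀ x ∈ Ioo a b, HasDerivAt f (f' x) x)
    (hpos : ∀ x ∈ Ioo a b, 0 < f' x) (g : ℝ → ℝ) :
    ∫ y in (f a)..(f b), g y = ∫ x in a..b, f' x * g (f x) := by
  have hmono : StrictMonoOn f (Icc a b) := by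
    refine strictMonoOn_of_deriv_pos (convex_Icc a b) hf fun x hx => ?_
    rw [interior_Icc] at hx
    rw [(hd x hx).deriv]; exact hpos x hx
  -- Only the open interval is used: the integrands may be singular at the endpoints.
  have himg : f '' Ioo a b = Ioo (f a) (f b) := by
    refine Subset.antisymm ?_ (intermediate_value_Ioo hab hf)
    rintro _ ⟨x, hx, rfl⟩
    exact ⟨hmono (left_mem_Icc.2 hab) (Ioo_subset_Icc_self hx) hx.1,
      hmono (Ioo_subset_Icc_self hx) (right_mem_Icc.2 hab) hx.2⟩
  have hle : f a ≤ f b := hmono.monotoneOn (left_mem_Icc.2 hab) (right_mem_Icc.2 hab) hab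
  rw [intervalIntegral.integral_of_le hle, intervalIntegral.integral_of_le hab,
    integral_Ioc_eq_integral_Ioo, integral_Ioc_eq_integral_Ioo, ← himg,
    integral_image_eq_integral_abs_deriv_smul measurableSet_Ioo
      (fun x hx => (hd x hx).hasDerivWithinAt)
      (hmono.injOn.mono Ioo_subset_Icc_self)]
  refine setIntegral_congr_fun measurableSet_Ioo fun x hx => ?_
  simp only [abs_of_pos (hpos x hx), smul_eq_mul]

/-- Change of variables along a decreasing map, without integrability assumptions. -/
lemma integral_comp_of_deriv_neg {f f' : ℝ → ℝ} {a b : ℝ} (hab : a ≤ b)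
    (hf : ContinuousOn f (Icc a b)) (hd : ∀ x ∈ Ioo a b, HasDerivAt f (f' x) x)
    (hneg : ∀ x ∈ Ioo a b, f' x < 0) (g : ℝ → ℝ) :
    ∫ y in (f b)..(f a), g y = ∫ x in a..b, -f' x * g (f x) := by
  have h := integral_comp_of_deriv_pos (f := fun x => -f x) (f' := fun x => -f' x) hab hf.neg
    (fun x hx => (hd x hx).neg) (fun x hx => neg_pos.2 (hneg x hx)) (fun y => g (-y))
  rw [intervalIntegral.integral_comp_neg, neg_neg, neg_neg] at h
  simpa using h

/-! ### Reduction of integrals of dλ/|R| to Legendre form -/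

/-- `|R(λ)|` for real `λ`. -/
def absR (c a l : ℝ) : ℝ := Real.sqrt |l * (l + c ^ 2) * (l + a ^ 2)|

lemma integral_congr_Ioo {f g : ℝ → ℝ} {a b : ℝ} (hab : a ≤ b) (h : ∀ x ∈ Ioo a b, f x = g x) :
    ∫ x in a..b, f x = ∫ x in a..b, g x := by
  rw [intervalIntegral.integral_of_le hab, intervalIntegral.integral_of_le hab,
    integral_Ioc_eq_integral_Ioo, integral_Ioc_eq_integral_Ioo]
  exact setIntegral_congr_fun measurableSet_Ioo h

lemma sin_cos_pos_of_mem {φ : ℝ} (hφ : φ ∈ Ioo 0 (Real.pi / 2)) :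
    0 < Real.sin φ ∧ 0 < Real.cos φ :=
  ⟨Real.sin_pos_of_pos_of_lt_pi hφ.1 (by linarith [hφ.2, Real.pi_pos]),
    Real.cos_pos_of_mem_Ioo ⟨by linarith [hφ.1, Real.pi_pos], hφ.2⟩⟩

lemma modulus_mem {c a : ℝ} (ha : 0 < a) (hac : a < c) : a ^ 2 / c ^ 2 ∈ Ioo (0 : ℝ) 1 := by
  have hc : 0 < c := ha.trans hac
  refine ⟨by positivity, ?_⟩
  rw [div_lt_one (by positivity)]
  exact pow_lt_pow_left₀ hac ha.le two_ne_zero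

/-- Substitution λ = -a² sin²φ. -/
lemma integral_gap {c a : ℝ} (ha : 0 < a) (hac : a < c) (g : ℝ → ℝ) :
    ∫ l in (-a ^ 2)..0, g l / absR c a l = ∫ φ in (0 : ℝ)..(Real.pi / 2),
      2 / c * (g (-(a ^ 2 * Real.sin φ ^ 2)) / ellDelta (a ^ 2 / c ^ 2) φ) := by
  have hc : 0 < c := ha.trans hac
  have hm := modulus_mem ha hac
  have h := integral_comp_of_deriv_neg (f := fun φ => -(a ^ 2 * Real.sin φ ^ 2))
    (f' := fun φ => -(2 * a ^ 2 * (Real.sin φ * Real.cos φ))) (a := 0) (b := Real.pi / 2)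
    (by positivity) (by fun_prop)
    (fun φ _ => by
      refine (((Real.hasDerivAt_sin φ).pow 2).const_mul (a ^ 2)).neg.congr_deriv ?_
      simp; ring)
    (fun φ hφ => by
      have := mul_pos (sin_cos_pos_of_mem hφ).1 (sin_cos_pos_of_mem hφ).2
      simp only [neg_lt_zero]; positivity)
    (fun l => g l / absR c a l)
  simp only [Real.sin_pi_div_two, Real.sin_zero] at h
  norm_num at h
  rw [h]
  refine integral_congr_Ioo (by positivity) fun φ hφ => ?_
  obtain ⟨hs, hco⟩ := sin_cos_pos_of_mem hφ
  have hD := ellDelta_pos hm.2 φ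
  have hR : absR c a (-(a ^ 2 * Real.sin φ ^ 2))
      = a ^ 2 * (Real.sin φ * Real.cos φ) * (c * ellDelta (a ^ 2 / c ^ 2) φ) := by
    have e : -(a ^ 2 * Real.sin φ ^ 2) * (-(a ^ 2 * Real.sin φ ^ 2) + c ^ 2)
        * (-(a ^ 2 * Real.sin φ ^ 2) + a ^ 2)
        = -(a ^ 2 * (Real.sin φ * Real.cos φ) * (c * ellDelta (a ^ 2 / c ^ 2) φ)) ^ 2 := by
      have h1 := ellDelta_sq hm.2 φ
      have h2 := Real.cos_sq' φ
      simp only [mul_pow]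
      rw [h1, h2]; field_simp; ring
    rw [absR, e, abs_neg, abs_of_nonneg (sq_nonneg _), Real.sqrt_sq (by positivity)]
  rw [hR]
  field_simp

/-- Substitution λ = -c² + (c² - a²) sin²φ, which produces the complementary parameter 1 - m. -/
lemma integral_cut {c a : ℝ} (ha : 0 < a) (hac : a < c) (g : ℝ → ℝ) :
    ∫ l in (-c ^ 2)..(-a ^ 2), g l / absR c a l = ∫ φ in (0 : ℝ)..(Real.pi / 2),
      2 / c * (g (-c ^ 2 + (c ^ 2 - a ^ 2) * Real.sin φ ^ 2)
        / ellDelta (1 - a ^ 2 / c ^ 2) φ) := by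
  have hc : 0 < c := ha.trans hac
  have hm := modulus_mem ha hac
  have hca : 0 < c ^ 2 - a ^ 2 := by nlinarith
  have h := integral_comp_of_deriv_pos (f := fun φ => -c ^ 2 + (c ^ 2 - a ^ 2) * Real.sin φ ^ 2)
    (f' := fun φ => 2 * (c ^ 2 - a ^ 2) * (Real.sin φ * Real.cos φ)) (a := 0) (b := Real.pi / 2)
    (by positivity) (by fun_prop)
    (fun φ _ => by
      refine (((Real.hasDerivAt_sin φ).pow 2).const_mul (c ^ 2 - a ^ 2)).const_add _
        |>.congr_deriv ?_
      simp; ring)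
    (fun φ hφ => by
      have := mul_pos (sin_cos_pos_of_mem hφ).1 (sin_cos_pos_of_mem hφ).2
      positivity)
    (fun l => g l / absR c a l)
  simp only [Real.sin_pi_div_two, Real.sin_zero] at h
  rw [show -c ^ 2 + (c ^ 2 - a ^ 2) * 0 ^ 2 = -c ^ 2 by ring,
    show -c ^ 2 + (c ^ 2 - a ^ 2) * 1 ^ 2 = -a ^ 2 by ring] at h
  rw [h]
  refine integral_congr_Ioo (by positivity) fun φ hφ => ?_
  obtain ⟨hs, hco⟩ := sin_cos_pos_of_mem hφ
  have hm' : 1 - a ^ 2 / c ^ 2 < 1 := by linarith [hm.1]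
  have hD := ellDelta_pos hm' φ
  have hR : absR c a (-c ^ 2 + (c ^ 2 - a ^ 2) * Real.sin φ ^ 2)
      = (c ^ 2 - a ^ 2) * (Real.sin φ * Real.cos φ) * (c * ellDelta (1 - a ^ 2 / c ^ 2) φ) := by
    have e : (-c ^ 2 + (c ^ 2 - a ^ 2) * Real.sin φ ^ 2)
        * (-c ^ 2 + (c ^ 2 - a ^ 2) * Real.sin φ ^ 2 + c ^ 2)
        * (-c ^ 2 + (c ^ 2 - a ^ 2) * Real.sin φ ^ 2 + a ^ 2)
        = ((c ^ 2 - a ^ 2) * (Real.sin φ * Real.cos φ)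
          * (c * ellDelta (1 - a ^ 2 / c ^ 2) φ)) ^ 2 := by
      have h1 := ellDelta_sq hm' φ
      have h2 := Real.cos_sq' φ
      simp only [mul_pow]
      rw [h1, h2]; field_simp; ring
    rw [absR, e, abs_of_nonneg (sq_nonneg _), Real.sqrt_sq (by positivity)]
  rw [hR]
  field_simp

/-- The moments of `dλ / |R|` over the gap. -/
lemma gap_moments {c a : ℝ} (ha : 0 < a) (hac : a < c) (p₀ p₁ p₂ : ℝ) :
    (∫ l in (-a ^ 2)..0, (p₀ + p₁ * l + p₂ * l ^ 2) / absR c a l)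
      = p₀ * (2 / c * ellK (a ^ 2 / c ^ 2))
        - p₁ * (2 * c * (ellK (a ^ 2 / c ^ 2) - ellE (a ^ 2 / c ^ 2)))
        + p₂ * (2 * c ^ 3 * (2 * (1 + a ^ 2 / c ^ 2)
          * (ellK (a ^ 2 / c ^ 2) - ellE (a ^ 2 / c ^ 2))
          - a ^ 2 / c ^ 2 * ellK (a ^ 2 / c ^ 2)) / 3) := by
  have hc : 0 < c := ha.trans hac
  have hm := modulus_mem ha hac
  rw [integral_gap ha hac (fun l => p₀ + p₁ * l + p₂ * l ^ 2),
    intervalIntegral.integral_const_mul]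
  have h : ∀ φ, p₀ + p₁ * (-(a ^ 2 * Real.sin φ ^ 2)) + p₂ * (-(a ^ 2 * Real.sin φ ^ 2)) ^ 2
      = p₀ + (-(p₁ * a ^ 2)) * Real.sin φ ^ 2 + (p₂ * a ^ 4) * Real.sin φ ^ 4 := by
    intro φ; ring
  simp_rw [h]
  rw [integral_quartic_div_ellDelta hm.1 hm.2]
  field_simp
  ring

/-- The moments of `dλ / |R|` over the cut `[-c², -a²]`. -/
lemma cut_moments {c a : ℝ} (ha : 0 < a) (hac : a < c) (p₀ p₁ p₂ : ℝ) :
    (∫ l in (-c ^ 2)..(-a ^ 2), (p₀ + p₁ * l + p₂ * l ^ 2) / absR c a l)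
      = p₀ * (2 / c * ellK (1 - a ^ 2 / c ^ 2))
        - p₁ * (2 * c * ellE (1 - a ^ 2 / c ^ 2))
        + p₂ * (2 * c ^ 3 * (2 * (1 + a ^ 2 / c ^ 2) * ellE (1 - a ^ 2 / c ^ 2)
          - a ^ 2 / c ^ 2 * ellK (1 - a ^ 2 / c ^ 2)) / 3) := by
  have hc : 0 < c := ha.trans hac
  have hm := modulus_mem ha hac
  rw [integral_cut ha hac (fun l => p₀ + p₁ * l + p₂ * l ^ 2),
    intervalIntegral.integral_const_mul]
  have h : ∀ φ, p₀ + p₁ * (-c ^ 2 + (c ^ 2 - a ^ 2) * Real.sin φ ^ 2)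
        + p₂ * (-c ^ 2 + (c ^ 2 - a ^ 2) * Real.sin φ ^ 2) ^ 2
      = (p₀ - p₁ * c ^ 2 + p₂ * c ^ 4)
        + ((c ^ 2 - a ^ 2) * (p₁ - 2 * p₂ * c ^ 2)) * Real.sin φ ^ 2
        + (p₂ * (c ^ 2 - a ^ 2) ^ 2) * Real.sin φ ^ 4 := by
    intro φ; ring
  simp_rw [h]
  rw [integral_quartic_div_ellDelta (by linarith [hm.2]) (by linarith [hm.1])]
  have hca : c ^ 2 - a ^ 2 ≠ 0 := by nlinarith
  field_simp
  ring

/-- Substitution λ = -c²/sin²φ. The value equals the integral over the gap, so the half-axis from ∞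
to -c² contributes exactly half an 𝔞-period, πi, to the Abel map. -/
lemma integral_left {c a : ℝ} (ha : 0 < a) (hac : a < c) :
    ∫ l in Iic (-c ^ 2 : ℝ), (absR c a l)⁻¹ = 2 / c * ellK (a ^ 2 / c ^ 2) := by
  have hc : 0 < c := ha.trans hac
  have hm := modulus_mem ha hac
  set f : ℝ → ℝ := fun φ => -c ^ 2 / Real.sin φ ^ 2 with hf
  set f' : ℝ → ℝ := fun φ => 2 * c ^ 2 * Real.cos φ / Real.sin φ ^ 3 with hf'
  have hinj : InjOn f (Ioo 0 (Real.pi / 2)) := by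
    intro x hx y hy hxy
    have hx1 := (sin_cos_pos_of_mem hx).1
    have hy1 := (sin_cos_pos_of_mem hy).1
    simp only [hf] at hxy
    rw [div_eq_div_iff (by positivity) (by positivity)] at hxy
    have h2 : Real.sin x ^ 2 = Real.sin y ^ 2 := by
      have := mul_left_cancel₀ (show -c ^ 2 ≠ 0 by simp [hc.ne']) hxy
      exact this.symm
    have h3 : Real.sin x = Real.sin y := (pow_left_inj₀ hx1.le hy1.le two_ne_zero).1 h2
    exact Real.injOn_sin ⟨by linarith [hx.1, Real.pi_pos], hx.2.le⟩
      ⟨by linarith [hy.1, Real.pi_pos], hy.2.le⟩ h3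
  have himg : f '' Ioo 0 (Real.pi / 2) = Iio (-c ^ 2) := by
    ext l
    constructor
    · rintro ⟨φ, hφ, rfl⟩
      obtain ⟨hs, hco⟩ := sin_cos_pos_of_mem hφ
      have h1 : Real.sin φ ^ 2 < 1 := by
        nlinarith [Real.sin_sq_add_cos_sq φ, sq_pos_of_pos hco]
      simp only [hf, mem_Iio]
      rw [div_lt_iff₀ (by positivity)]
      nlinarith [sq_pos_of_pos hc]
    · intro hl
      rw [mem_Iio] at hl
      have hl0 : 0 < -l := by nlinarith [sq_pos_of_pos hc]
      have hs0 : 0 < Real.sqrt (-l) := Real.sqrt_pos.2 hl0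
      have hlt : c < Real.sqrt (-l) := by
        rw [Real.lt_sqrt hc.le]; linarith
      refine ⟨Real.arcsin (c / Real.sqrt (-l)), ⟨Real.arcsin_pos.2 (by positivity), ?_⟩, ?_⟩
      · rw [Real.arcsin_lt_pi_div_two, div_lt_one hs0]; exact hlt
      · have : c / Real.sqrt (-l) ≤ 1 := by rw [div_le_one hs0]; exact hlt.le
        simp only [hf]
        rw [Real.sin_arcsin (by have : 0 ≤ c / Real.sqrt (-l) := by positivity
                                linarith) this, div_pow, Real.sq_sqrt hl0.le]
        field_simp
  rw [integral_Iic_eq_integral_Iio, ← himg,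
    integral_image_eq_integral_abs_deriv_smul measurableSet_Ioo (f' := f') _ hinj]
  · rw [ellK, ← intervalIntegral.integral_const_mul, intervalIntegral.integral_of_le (by positivity),
      integral_Ioc_eq_integral_Ioo]
    refine setIntegral_congr_fun measurableSet_Ioo fun φ hφ => ?_
    obtain ⟨hs, hco⟩ := sin_cos_pos_of_mem hφ
    have hD := ellDelta_pos hm.2 φ
    have hR : absR c a (f φ)
        = c ^ 3 * Real.cos φ * ellDelta (a ^ 2 / c ^ 2) φ / Real.sin φ ^ 3 := by
      have e : f φ * (f φ + c ^ 2) * (f φ + a ^ 2)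
          = -(c ^ 3 * Real.cos φ * ellDelta (a ^ 2 / c ^ 2) φ / Real.sin φ ^ 3) ^ 2 := by
        have h1 := ellDelta_sq hm.2 φ
        have h2 := Real.cos_sq' φ
        simp only [hf, mul_pow, div_pow]
        rw [h1, h2]; field_simp; ring
      rw [absR, e, abs_neg, abs_of_nonneg (sq_nonneg _), Real.sqrt_sq (by positivity)]
    have hp : 0 < f' φ := by simp only [hf']; positivity
    simp only [abs_of_pos hp, smul_eq_mul]
    rw [hR, hf']
    field_simp
  · intro φ hφ
    obtain ⟨hs, hco⟩ := sin_cos_pos_of_mem hφ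
    have h := ((Real.hasDerivAt_sin φ).pow 2).inv (pow_pos hs 2).ne'
    refine ((h.const_mul (-c ^ 2)).congr_deriv ?_).hasDerivWithinAt
    simp only [hf', Pi.pow_apply]
    field_simp
    norm_num
    ring

/-! ### The branch equation and the phase -/

/-- Substitution s = a sin φ. The prefactor is positive, so the branch equation becomes ξ =
c²·`modX`(a²/c²). -/
lemma branch_integral {c a : ℝ} (ha : 0 < a) (hac : a < c) (ξ : ℝ) :
    (∫ s in (0 : ℝ)..a, (ξ + (c ^ 2 - a ^ 2) / 2 - s ^ 2)
      * Real.sqrt ((a ^ 2 - s ^ 2) / (c ^ 2 - s ^ 2)))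
    = c * (ellE (a ^ 2 / c ^ 2) - (1 - a ^ 2 / c ^ 2) * ellK (a ^ 2 / c ^ 2))
      * (ξ - c ^ 2 * modX (a ^ 2 / c ^ 2)) := by
  have hc : 0 < c := ha.trans hac
  have hm := modulus_mem ha hac
  have h := integral_comp_of_deriv_pos (f := fun φ => a * Real.sin φ)
    (f' := fun φ => a * Real.cos φ) (a := 0) (b := Real.pi / 2)
    (by positivity) (by fun_prop) (fun φ _ => (Real.hasDerivAt_sin φ).const_mul a)
    (fun φ hφ => mul_pos ha (sin_cos_pos_of_mem hφ).2)
    (fun s => (ξ + (c ^ 2 - a ^ 2) / 2 - s ^ 2) * Real.sqrt ((a ^ 2 - s ^ 2) / (c ^ 2 - s ^ 2)))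
  simp only [Real.sin_pi_div_two, Real.sin_zero, mul_zero, mul_one] at h
  have h2 : ∀ φ ∈ Ioo 0 (Real.pi / 2), a * Real.cos φ * ((ξ + (c ^ 2 - a ^ 2) / 2
      - (a * Real.sin φ) ^ 2) * Real.sqrt ((a ^ 2 - (a * Real.sin φ) ^ 2)
        / (c ^ 2 - (a * Real.sin φ) ^ 2)))
      = a ^ 2 / c * (((ξ + (c ^ 2 - a ^ 2) / 2) + (-(ξ + (c ^ 2 - a ^ 2) / 2) - a ^ 2)
        * Real.sin φ ^ 2 + a ^ 2 * Real.sin φ ^ 4) / ellDelta (a ^ 2 / c ^ 2) φ) := by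
    intro φ hφ
    obtain ⟨hs, hco⟩ := sin_cos_pos_of_mem hφ
    have hD := ellDelta_pos hm.2 φ
    have h1 := ellDelta_sq hm.2 φ
    have e : (a ^ 2 - (a * Real.sin φ) ^ 2) / (c ^ 2 - (a * Real.sin φ) ^ 2)
        = (a * Real.cos φ / (c * ellDelta (a ^ 2 / c ^ 2) φ)) ^ 2 := by
      rw [show c ^ 2 - (a * Real.sin φ) ^ 2 = (c * ellDelta (a ^ 2 / c ^ 2) φ) ^ 2 by
        rw [mul_pow, mul_pow, h1]; field_simp,
        show a ^ 2 - (a * Real.sin φ) ^ 2 = (a * Real.cos φ) ^ 2 by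
        rw [mul_pow, mul_pow, Real.cos_sq']; ring, div_pow]
    rw [e, Real.sqrt_sq (by positivity)]
    have h3 := Real.cos_sq' φ
    field_simp
    rw [h3]; ring
  rw [h, integral_congr_Ioo (by positivity) h2, intervalIntegral.integral_const_mul,
    integral_quartic_div_ellDelta hm.1 hm.2, modX]
  have hD := (ellE_sub_pos hm.1 hm.2).ne'
  have e : ∀ K E m : ℝ, E - (1 - m) * K ≠ 0 →
      c * (E - (1 - m) * K) * (ξ - c ^ 2 * ((1 + m) / 6 - m * (1 - m) * K
        / (3 * (E - (1 - m) * K)))) = c * (E - (1 - m) * K) * (ξ - c ^ 2 * (1 + m) / 6)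
          + c ^ 3 * m * (1 - m) * K / 3 := by
    intro K E m h; field_simp; ring
  rw [e _ _ _ hD]
  field_simp
  ring

lemma isBranchParam_iff {c ξ a : ℝ} :
    IsBranchParam c ξ a ↔ 0 < a ∧ a < c ∧ modX (a ^ 2 / c ^ 2) = ξ / c ^ 2 := by
  unfold IsBranchParam
  refine and_congr_right fun ha => and_congr_right fun hac => ?_
  have hc : 0 < c := ha.trans hac
  have hm := modulus_mem ha hac
  have hD := (ellE_sub_pos hm.1 hm.2).ne'
  rw [branch_integral ha hac, mul_eq_zero, or_iff_right (mul_ne_zero hc.ne' hD), sub_eq_zero,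
    eq_div_iff (by positivity), mul_comm, eq_comm]

lemma phase_integral {c a : ℝ} (ha : 0 < a) (hac : a < c) (ξ : ℝ) :
    (∫ s in a..c, (ξ + (c ^ 2 - a ^ 2) / 2 - s ^ 2)
      * Real.sqrt ((s ^ 2 - a ^ 2) / (c ^ 2 - s ^ 2)))
    = c * (ellE (1 - a ^ 2 / c ^ 2) * (ξ - c ^ 2 * (1 + a ^ 2 / c ^ 2) / 6)
      + a ^ 2 / c ^ 2 * ellK (1 - a ^ 2 / c ^ 2)
        * (-ξ - c ^ 2 / 6 + c ^ 2 * (a ^ 2 / c ^ 2) / 2)) := by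
  have hc : 0 < c := ha.trans hac
  have hm := modulus_mem ha hac
  have hm' : 1 - a ^ 2 / c ^ 2 < 1 := by linarith [hm.1]
  have hm0 : 0 < 1 - a ^ 2 / c ^ 2 := by linarith [hm.2]
  -- Substitution s = cΔ(1-m, φ), decreasing from c at φ = 0 to a at φ = π/2.
  have h := integral_comp_of_deriv_neg (f := fun φ => c * ellDelta (1 - a ^ 2 / c ^ 2) φ)
    (f' := fun φ => c * (-((1 - a ^ 2 / c ^ 2) * Real.sin φ * Real.cos φ)
      / ellDelta (1 - a ^ 2 / c ^ 2) φ)) (a := 0) (b := Real.pi / 2)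
    (by positivity) (continuous_const.mul (continuous_ellDelta _)).continuousOn
    (fun φ _ => (hasDerivAt_ellDelta_angle hm' φ).const_mul c)
    (fun φ hφ => by
      obtain ⟨hs, hco⟩ := sin_cos_pos_of_mem hφ
      have hD := ellDelta_pos hm' φ
      refine mul_neg_of_pos_of_neg hc (div_neg_of_neg_of_pos ?_ hD)
      rw [neg_lt_zero]; positivity)
    (fun s => (ξ + (c ^ 2 - a ^ 2) / 2 - s ^ 2) * Real.sqrt ((s ^ 2 - a ^ 2) / (c ^ 2 - s ^ 2)))
  have e0 : c * ellDelta (1 - a ^ 2 / c ^ 2) 0 = c := by simp [ellDelta]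
  have e1 : c * ellDelta (1 - a ^ 2 / c ^ 2) (Real.pi / 2) = a := by
    simp only [ellDelta, Real.sin_pi_div_two]
    rw [show 1 - (1 - a ^ 2 / c ^ 2) * 1 ^ 2 = (a / c) ^ 2 by ring, Real.sqrt_sq (by positivity)]
    field_simp
  rw [e0, e1] at h
  have h2 : ∀ φ ∈ Ioo 0 (Real.pi / 2), -(c * (-((1 - a ^ 2 / c ^ 2) * Real.sin φ * Real.cos φ)
      / ellDelta (1 - a ^ 2 / c ^ 2) φ)) * ((ξ + (c ^ 2 - a ^ 2) / 2
      - (c * ellDelta (1 - a ^ 2 / c ^ 2) φ) ^ 2) *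
        Real.sqrt (((c * ellDelta (1 - a ^ 2 / c ^ 2) φ) ^ 2 - a ^ 2)
        / (c ^ 2 - (c * ellDelta (1 - a ^ 2 / c ^ 2) φ) ^ 2)))
      = c * (1 - a ^ 2 / c ^ 2) * (((ξ + (c ^ 2 - a ^ 2) / 2 - c ^ 2)
        + (-(ξ + (c ^ 2 - a ^ 2) / 2 - c ^ 2) + (c ^ 2 - a ^ 2)) * Real.sin φ ^ 2
        + (-(c ^ 2 - a ^ 2)) * Real.sin φ ^ 4) / ellDelta (1 - a ^ 2 / c ^ 2) φ) := by
    intro φ hφ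
    obtain ⟨hs, hco⟩ := sin_cos_pos_of_mem hφ
    have hD := ellDelta_pos hm' φ
    have h1 := ellDelta_sq hm' φ
    have h3 := Real.cos_sq' φ
    have hca : 0 < c ^ 2 - a ^ 2 := by nlinarith
    have e : ((c * ellDelta (1 - a ^ 2 / c ^ 2) φ) ^ 2 - a ^ 2)
        / (c ^ 2 - (c * ellDelta (1 - a ^ 2 / c ^ 2) φ) ^ 2)
        = (Real.cos φ / Real.sin φ) ^ 2 := by
      rw [mul_pow, h1, div_pow, h3]
      rw [show c ^ 2 * (1 - (1 - a ^ 2 / c ^ 2) * Real.sin φ ^ 2) - a ^ 2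
        = (c ^ 2 - a ^ 2) * (1 - Real.sin φ ^ 2) by field_simp; ring,
        show c ^ 2 - c ^ 2 * (1 - (1 - a ^ 2 / c ^ 2) * Real.sin φ ^ 2)
        = (c ^ 2 - a ^ 2) * Real.sin φ ^ 2 by field_simp; ring]
      exact mul_div_mul_left _ _ hca.ne'
    rw [e, Real.sqrt_sq (by positivity), mul_pow, h1]
    have e3 : c ^ 2 * (1 - (1 - a ^ 2 / c ^ 2) * Real.sin φ ^ 2)
        = c ^ 2 - (c ^ 2 - a ^ 2) * Real.sin φ ^ 2 := by field_simp
    rw [e3]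
    generalize 1 - a ^ 2 / c ^ 2 = m' at *
    field_simp
    rw [h3]; ring
  rw [h, integral_congr_Ioo (by positivity) h2, intervalIntegral.integral_const_mul,
    integral_quartic_div_ellDelta hm0 hm']
  have hca : c ^ 2 - a ^ 2 ≠ 0 := by nlinarith
  field_simp
  ring

lemma gapInt_eq {c ξ : ℝ} (ha : 0 < aFun c ξ) (hac : aFun c ξ < c) :
    gapInt c ξ = 2 / c * ellK (aFun c ξ ^ 2 / c ^ 2) := by
  unfold gapInt
  generalize aFun c ξ = a at *
  have hc : 0 < c := ha.trans hac
  have hm := modulus_mem ha hac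
  have h := integral_comp_of_deriv_pos (f := fun φ => a * Real.sin φ)
    (f' := fun φ => a * Real.cos φ) (a := -(Real.pi / 2)) (b := Real.pi / 2)
    (by linarith [Real.pi_pos]) (by fun_prop) (fun φ _ => (Real.hasDerivAt_sin φ).const_mul a)
    (fun φ hφ => mul_pos ha (Real.cos_pos_of_mem_Ioo hφ))
    (fun s => (Real.sqrt ((c ^ 2 - s ^ 2) * (a ^ 2 - s ^ 2)))⁻¹)
  simp only [Real.sin_neg, Real.sin_pi_div_two, mul_neg, mul_one] at h
  have h2 : ∀ φ ∈ Ioo (-(Real.pi / 2)) (Real.pi / 2), a * Real.cos φ *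
      (Real.sqrt ((c ^ 2 - (a * Real.sin φ) ^ 2) * (a ^ 2 - (a * Real.sin φ) ^ 2)))⁻¹
      = c⁻¹ * (ellDelta (a ^ 2 / c ^ 2) φ)⁻¹ := by
    intro φ hφ
    have hco := Real.cos_pos_of_mem_Ioo hφ
    have hD := ellDelta_pos hm.2 φ
    have h1 := ellDelta_sq hm.2 φ
    rw [show (c ^ 2 - (a * Real.sin φ) ^ 2) * (a ^ 2 - (a * Real.sin φ) ^ 2)
      = (c * ellDelta (a ^ 2 / c ^ 2) φ * (a * Real.cos φ)) ^ 2 by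
        simp only [mul_pow]; rw [h1, Real.cos_sq']; field_simp, Real.sqrt_sq (by positivity)]
    field_simp
  rw [h, integral_congr_Ioo (by linarith [Real.pi_pos]) h2, intervalIntegral.integral_const_mul]
  have hcont : Continuous fun φ => (ellDelta (a ^ 2 / c ^ 2) φ)⁻¹ :=
    (continuous_ellDelta _).inv₀ fun φ => (ellDelta_pos hm.2 φ).ne'
  rw [← intervalIntegral.integral_add_adjacent_intervals (b := 0)
    (hcont.intervalIntegrable _ _) (hcont.intervalIntegrable _ _)]
  have hneg : (∫ φ in (-(Real.pi / 2))..0, (ellDelta (a ^ 2 / c ^ 2) φ)⁻¹)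
      = ellK (a ^ 2 / c ^ 2) := by
    have := intervalIntegral.integral_comp_neg (a := 0) (b := Real.pi / 2)
      (fun φ => (ellDelta (a ^ 2 / c ^ 2) φ)⁻¹)
    rw [neg_zero] at this
    rw [← this]
    simp [ellK, ellDelta]
  rw [hneg]
  change c⁻¹ * (ellK _ + ellK _) = _
  ring

/-! ### The function `a(ξ)` -/

lemma existsUnique_isBranchParam {c ξ : ℝ} (hc : 0 < c)
    (hξ : ξ ∈ Ioo (-c ^ 2 / 2) (c ^ 2 / 3)) : ∃! a : ℝ, IsBranchParam c ξ a := by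
  have hc2 : 0 < c ^ 2 := by positivity
  have hx : ξ / c ^ 2 ∈ Ioo (-1 / 2 : ℝ) (1 / 3) := by
    constructor
    · rw [lt_div_iff₀ hc2]; linarith [hξ.1]
    · rw [div_lt_iff₀ hc2]; linarith [hξ.2]
  obtain ⟨m, hm, hmx⟩ := exists_modX_eq hx
  have hs : 0 < Real.sqrt m := Real.sqrt_pos.2 hm.1
  have hs2 : Real.sqrt m ^ 2 = m := Real.sq_sqrt hm.1.le
  refine ⟨c * Real.sqrt m, ?_, fun a ha => ?_⟩
  · refine isBranchParam_iff.2 ?_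
    refine ⟨by positivity, ?_, ?_⟩
    · have : Real.sqrt m < 1 := by rw [Real.sqrt_lt' one_pos]; simpa using hm.2
      nlinarith
    · rw [mul_pow, hs2, mul_div_cancel_left₀ _ hc2.ne', hmx]
  · obtain ⟨ha0, hac, hax⟩ := isBranchParam_iff.1 ha
    have hma := modulus_mem ha0 hac
    have : a ^ 2 / c ^ 2 = m := strictMonoOn_modX.injOn hma hm (hax.trans hmx.symm)
    rw [← this, Real.sqrt_div (by positivity), Real.sqrt_sq ha0.le, Real.sqrt_sq hc.le]
    field_simp

lemma aFun_spec {c ξ : ℝ} (hc : 0 < c) (hξ : ξ ∈ Ioo (-c ^ 2 / 2) (c ^ 2 / 3)) :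
    IsBranchParam c ξ (aFun c ξ) :=
  Classical.epsilon_spec (existsUnique_isBranchParam hc hξ).exists

lemma modX_aFun {c ξ : ℝ} (hc : 0 < c) (hξ : ξ ∈ Ioo (-c ^ 2 / 2) (c ^ 2 / 3)) :
    c ^ 2 * modX (aFun c ξ ^ 2 / c ^ 2) = ξ := by
  rw [(isBranchParam_iff.1 (aFun_spec hc hξ)).2.2]
  field_simp

lemma modulus_aFun_mem {c ξ : ℝ} (hc : 0 < c) (hξ : ξ ∈ Ioo (-c ^ 2 / 2) (c ^ 2 / 3)) :
    aFun c ξ ^ 2 / c ^ 2 ∈ Ioo (0 : ℝ) 1 :=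
  modulus_mem (aFun_spec hc hξ).1 (aFun_spec hc hξ).2.1

/-- `aFun` is a mere choice, but ξ ↦ a(ξ)²/c² inverts the strictly increasing c²·`modX`; it is
therefore strictly increasing, its image contains a neighbourhood of each of its values, and it is
continuous. -/
lemma continuousAt_modulus {c ξ : ℝ} (hc : 0 < c) (hξ : ξ ∈ Ioo (-c ^ 2 / 2) (c ^ 2 / 3)) :
    ContinuousAt (fun ξ => aFun c ξ ^ 2 / c ^ 2) ξ := by
  have hc2 : 0 < c ^ 2 := by positivity
  refine StrictMonoOn.continuousAt_of_image_mem_nhds (s := Ioo (-c ^ 2 / 2) (c ^ 2 / 3)) ?_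
    (isOpen_Ioo.mem_nhds hξ) ?_
  · intro x hx y hy hxy
    rw [← strictMonoOn_modX.lt_iff_lt (modulus_aFun_mem hc hx) (modulus_aFun_mem hc hy)]
    refine lt_of_mul_lt_mul_left ?_ hc2.le
    rwa [modX_aFun hc hx, modX_aFun hc hy]
  · have hm := modulus_aFun_mem hc hξ
    have hcont : ContinuousAt (fun m => c ^ 2 * modX m) (aFun c ξ ^ 2 / c ^ 2) :=
      continuousAt_const.mul (hasDerivAt_modX hm.1 hm.2).continuousAt
    have h1 := hcont.preimage_mem_nhds (t := Ioo (-c ^ 2 / 2) (c ^ 2 / 3)) (by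
      rw [modX_aFun hc hξ]; exact isOpen_Ioo.mem_nhds hξ)
    filter_upwards [h1, isOpen_Ioo.mem_nhds hm] with m hm1 hm2
    refine ⟨c ^ 2 * modX m, hm1, ?_⟩
    refine strictMonoOn_modX.injOn (modulus_aFun_mem hc hm1) hm2 ?_
    exact mul_left_cancel₀ hc2.ne' (modX_aFun hc hm1)

lemma hasDerivAt_modulus {c ξ : ℝ} (hc : 0 < c) (hξ : ξ ∈ Ioo (-c ^ 2 / 2) (c ^ 2 / 3)) {m : ℝ}
    (hm : aFun c ξ ^ 2 / c ^ 2 = m) :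
    HasDerivAt (fun ξ => aFun c ξ ^ 2 / c ^ 2)
      (c ^ 2 * (ellK m * (3 * m - 1 - 2 * modX m) / (4 * (ellE m - (1 - m) * ellK m))))⁻¹ ξ := by
  have hmem := modulus_aFun_mem hc hξ
  rw [hm] at hmem
  have h1 := ellE_sub_pos hmem.1 hmem.2
  have h2 := ellK_pos hmem.2
  have h3 := modX_gap_pos hmem.1 hmem.2
  refine HasDerivAt.of_local_left_inverse (f := fun m => c ^ 2 * modX m)
    (continuousAt_modulus hc hξ) ?_ (by positivity) ?_
  · rw [hm]; exact (hasDerivAt_modX hmem.1 hmem.2).const_mul (c ^ 2)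
  · filter_upwards [isOpen_Ioo.mem_nhds hξ] with y hy using modX_aFun hc hy

/-- As a function of ξ and m, z satisfies ∂z/∂m = 3c⁴(3m - 1 - 2X) at ξ = c²X. This factor cancels
the one in the denominator of dm/dξ. The result is 6(a² + c² + 2h). -/
lemma hasDerivAt_zRH {c ξ : ℝ} (hc : 0 < c) (hξ : ξ ∈ Ioo (-c ^ 2 / 2) (c ^ 2 / 3)) {m : ℝ}
    (hm : aFun c ξ ^ 2 / c ^ 2 = m) :
    HasDerivAt (zRH c) (6 * c ^ 2 * (m + 1 - 2 * (ellK m - ellE m) / ellK m)) ξ := by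
  have hmem := modulus_aFun_mem hc hξ
  have hd := hasDerivAt_modulus hc hξ hm
  have hX := modX_aFun hc hξ
  rw [hm] at hmem hX
  have h1 := (ellE_sub_pos hmem.1 hmem.2).ne'
  have h2 := (ellK_pos hmem.2).ne'
  have h3 := (modX_gap_pos hmem.1 hmem.2).ne'
  have heq : zRH c = fun ξ => (12 * c ^ 2 * (ξ * (1 - aFun c ξ ^ 2 / c ^ 2)) + 3 * c ^ 4
      + 9 * c ^ 4 * (aFun c ξ ^ 2 / c ^ 2) ^ 2 - 6 * c ^ 4 * (aFun c ξ ^ 2 / c ^ 2)) / 2 := by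
    funext ξ
    rw [zRH]; field_simp
  rw [heq]
  have h := (((((hasDerivAt_id ξ).mul (hd.const_sub 1)).const_mul (12 * c ^ 2)).add_const
    (3 * c ^ 4)).add ((hd.pow 2).const_mul (9 * c ^ 4))).sub (hd.const_mul (6 * c ^ 4))
    |>.div_const 2
  refine h.congr_deriv ?_
  simp only [hm, id]
  rw [← hX]
  generalize modX m = x at h3 ⊢
  -- The new variable y = 3m - 1 - 2X turns the nonvanishing denominator into a single symbol that
  -- can be cancelled.
  obtain ⟨y, rfl⟩ : ∃ y, x = (3 * m - 1 - y) / 2 := ⟨3 * m - 1 - 2 * x, by ring⟩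
  rw [show 3 * m - 1 - 2 * ((3 * m - 1 - y) / 2) = y by ring] at h3 ⊢
  field_simp
  ring

/-- In closed form ∂B/∂m = 6c³(3m - 1 - 2X)K', with the factor that dm/dξ cancels, and ∂B/∂ξ =
24c(E' - mK'). Their combination is 24c/K times the left side of Legendre's relation. -/
lemma hasDerivAt_phaseB {c ξ : ℝ} (hc : 0 < c) (hξ : ξ ∈ Ioo (-c ^ 2 / 2) (c ^ 2 / 3)) {m : ℝ}
    (hm : aFun c ξ ^ 2 / c ^ 2 = m) :
    HasDerivAt (phaseB c) (12 * Real.pi * c / ellK m) ξ := by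
  have hmem := modulus_aFun_mem hc hξ
  have hd := hasDerivAt_modulus hc hξ hm
  have hX := modX_aFun hc hξ
  rw [hm] at hmem hX
  have h1 := (ellE_sub_pos hmem.1 hmem.2).ne'
  have h2 := (ellK_pos hmem.2).ne'
  have h3 := (modX_gap_pos hmem.1 hmem.2).ne'
  have heq : phaseB c =ᶠ[𝓝 ξ] fun ξ => 24 * (c * (ellE (1 - aFun c ξ ^ 2 / c ^ 2)
      * (ξ - c ^ 2 * (1 + aFun c ξ ^ 2 / c ^ 2) / 6)
      + aFun c ξ ^ 2 / c ^ 2 * ellK (1 - aFun c ξ ^ 2 / c ^ 2)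
        * (-ξ - c ^ 2 / 6 + c ^ 2 * (aFun c ξ ^ 2 / c ^ 2) / 2))) := by
    filter_upwards [isOpen_Ioo.mem_nhds hξ] with y hy
    rw [phaseB, phase_integral (aFun_spec hc hy).1 (aFun_spec hc hy).2.1]
  refine HasDerivAt.congr_of_eventuallyEq ?_ heq
  have hd' := hd.const_sub 1
  have hE : HasDerivAt ellE _ (1 - aFun c ξ ^ 2 / c ^ 2) :=
    hasDerivAt_ellE (by rw [hm]; linarith [hmem.2]) (by rw [hm]; linarith [hmem.1])
  have hK : HasDerivAt ellK _ (1 - aFun c ξ ^ 2 / c ^ 2) :=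
    hasDerivAt_ellK (by rw [hm]; linarith [hmem.2]) (by rw [hm]; linarith [hmem.1])
  have hE' := hE.comp ξ hd'
  have hK' := hK.comp ξ hd'
  have hid := hasDerivAt_id ξ
  have h := (((hE'.mul (hid.sub (((hd.const_add 1).const_mul (c ^ 2)).div_const 6))).add
    ((hd.mul hK').mul ((hid.neg.sub_const (c ^ 2 / 6)).add
      ((hd.const_mul (c ^ 2)).div_const 2)))).const_mul c).const_mul 24
  refine h.congr_deriv ?_
  have hL := legendre_relation hmem.1 hmem.2
  simp only [Function.comp, Pi.mul_apply, Pi.sub_apply, Pi.add_apply, Pi.neg_apply, hm, id]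
  rw [← hX]
  have h4 : 1 - m ≠ 0 := by linarith [hmem.2]
  have h5 : m ≠ 0 := hmem.1.ne'
  have e : (12 * Real.pi * c / ellK m) = 24 * c * (ellE (1 - m) * ellK m
      + ellE m * ellK (1 - m) - ellK m * ellK (1 - m)) / ellK m := by rw [hL]; ring
  rw [e, sub_sub_cancel]
  generalize modX m = x at h3 ⊢
  generalize ellE (1 - m) = E'
  generalize ellK (1 - m) = K'
  obtain ⟨y, rfl⟩ : ∃ y, x = (3 * m - 1 - y) / 2 := ⟨3 * m - 1 - 2 * x, by ring⟩
  rw [show 3 * m - 1 - 2 * ((3 * m - 1 - y) / 2) = y by ring] at h3 ⊢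
  have hp : (c ^ 2 * (ellK m * y / (4 * (ellE m - (1 - m) * ellK m))))⁻¹
      = 4 * (ellE m - (1 - m) * ellK m) / (c ^ 2 * ellK m * y) := by
    field_simp
  rw [hp]
  field_simp
  ring

/-! ### Periods -/

lemma sqrtCut_of_nonneg {r : ℝ} (hr : 0 ≤ r) : sqrtCut (r : ℂ) = (Real.sqrt r : ℂ) := by
  rw [sqrtCut, if_pos (by simp), Real.sqrt_eq_rpow, Complex.ofReal_cpow hr]
  norm_num

lemma sqrtCut_of_nonpos {r : ℝ} (hr : r ≤ 0) :
    sqrtCut (r : ℂ) = Complex.I * (Real.sqrt (-r) : ℂ) := by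
  rw [sqrtCut, if_pos (by simp), Complex.ofReal_cpow_of_nonpos hr, Real.sqrt_eq_rpow,
    Complex.ofReal_cpow (by linarith), mul_comm]
  congr 1
  · rw [show (Real.pi : ℂ) * Complex.I * (1 / 2) = Real.pi / 2 * Complex.I by ring,
      Complex.exp_pi_div_two_mul_I]
  · norm_num

lemma curveR_ofReal (c a l : ℝ) : curveR c a l
    = sqrtCut (l : ℂ) * sqrtCut ((l + c ^ 2 : ℝ) : ℂ) * sqrtCut ((l + a ^ 2 : ℝ) : ℂ) := by
  simp [curveR]

/-- Each negative factor under the root contributes one i. There are one, two and three of them on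
the gap, the cut and the left half-axis, whence R = i|R|, -|R| and -i|R|. -/
lemma curveR_gap {c a l : ℝ} (hac : a ^ 2 ≤ c ^ 2) (hl : l ∈ Icc (-a ^ 2) 0) :
    curveR c a l = Complex.I * (absR c a l : ℂ) := by
  have h1 : 0 ≤ l + a ^ 2 := by linarith [hl.1]
  have h2 : 0 ≤ l + c ^ 2 := by linarith
  have h3 : 0 ≤ -l := by linarith [hl.2]
  rw [curveR_ofReal, sqrtCut_of_nonpos hl.2, sqrtCut_of_nonneg h2, sqrtCut_of_nonneg h1, absR,
    abs_mul, abs_mul, abs_of_nonpos hl.2, abs_of_nonneg h1, abs_of_nonneg h2,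
    Real.sqrt_mul (by positivity), Real.sqrt_mul h3]
  push_cast; ring

lemma curveR_cut {c a l : ℝ} (hl : l ∈ Icc (-c ^ 2) (-a ^ 2)) :
    curveR c a l = -(absR c a l : ℂ) := by
  have h0 : l ≤ 0 := by nlinarith [hl.2, sq_nonneg a]
  have h1 : l + a ^ 2 ≤ 0 := by linarith [hl.2]
  have h2 : 0 ≤ l + c ^ 2 := by linarith [hl.1]
  have h3 : 0 ≤ -l := by linarith
  rw [curveR_ofReal, sqrtCut_of_nonpos h0, sqrtCut_of_nonneg h2, sqrtCut_of_nonpos h1, absR,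
    abs_mul, abs_mul, abs_of_nonpos h0, abs_of_nonpos h1, abs_of_nonneg h2,
    Real.sqrt_mul (by positivity), Real.sqrt_mul h3]
  push_cast
  linear_combination ((Real.sqrt (-l) : ℂ) * Real.sqrt (l + c ^ 2) * Real.sqrt (-(l + a ^ 2)))
    * Complex.I_sq

lemma curveR_left {c a l : ℝ} (hac : a ^ 2 ≤ c ^ 2) (hl : l ≤ -c ^ 2) :
    curveR c a l = -(Complex.I * (absR c a l : ℂ)) := by
  have h0 : l ≤ 0 := by nlinarith [sq_nonneg c]
  have h1 : l + a ^ 2 ≤ 0 := by linarith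
  have h2 : l + c ^ 2 ≤ 0 := by linarith
  have h3 : 0 ≤ -l := by linarith
  have h4 : 0 ≤ -(l + c ^ 2) := by linarith
  rw [curveR_ofReal, sqrtCut_of_nonpos h0, sqrtCut_of_nonpos h2, sqrtCut_of_nonpos h1, absR,
    abs_mul, abs_mul, abs_of_nonpos h0, abs_of_nonpos h1, abs_of_nonpos h2,
    Real.sqrt_mul (by positivity), Real.sqrt_mul h3]
  push_cast
  linear_combination (Complex.I * (Real.sqrt (-l) : ℂ) * Real.sqrt (-(l + c ^ 2))
    * Real.sqrt (-(l + a ^ 2))) * Complex.I_sq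

lemma integral_div_curveR_gap {c a : ℝ} (hac : a ^ 2 ≤ c ^ 2) {f : ℂ → ℂ} {k : ℂ} {g : ℝ → ℝ}
    (hf : ∀ l : ℝ, f l = k * g l) {b : ℝ} (hb : b ∈ Icc (-a ^ 2) 0) :
    ∫ l in (-a ^ 2)..b, f (l : ℂ) / curveR c a l
      = -(Complex.I * k * ((∫ l in (-a ^ 2)..b, g l / absR c a l : ℝ) : ℂ)) := by
  rw [← intervalIntegral.integral_ofReal, ← intervalIntegral.integral_const_mul,
    ← intervalIntegral.integral_neg]
  refine intervalIntegral.integral_congr fun l hl => ?_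
  rw [uIcc_of_le hb.1] at hl
  rw [hf, curveR_gap hac ⟨hl.1, hl.2.trans hb.2⟩, div_mul_eq_div_div_swap]
  push_cast
  rw [Complex.div_I]
  ring

lemma integral_div_curveR_cut {c a : ℝ} (hac : a ^ 2 ≤ c ^ 2) {f : ℂ → ℂ} {k : ℂ} {g : ℝ → ℝ}
    (hf : ∀ l : ℝ, f l = k * g l) :
    ∫ l in (-c ^ 2)..(-a ^ 2), f (l : ℂ) / curveR c a l
      = -(k * ((∫ l in (-c ^ 2)..(-a ^ 2), g l / absR c a l : ℝ) : ℂ)) := by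
  rw [← intervalIntegral.integral_ofReal, ← intervalIntegral.integral_const_mul,
    ← intervalIntegral.integral_neg]
  refine intervalIntegral.integral_congr fun l hl => ?_
  rw [uIcc_of_le (by linarith)] at hl
  rw [hf, curveR_cut hl]
  push_cast
  ring

/-- On the way back both the direction and the sign of y are reversed, so the period is twice the
one-way integral. The same holds for `bPeriod_eq`. -/
lemma aPeriod_eq {c a : ℝ} (hac : a ^ 2 ≤ c ^ 2) {f : ℂ → ℂ} {k : ℂ} {g : ℝ → ℝ}
    (hf : ∀ l : ℝ, f l = k * g l) :
    aPeriod c a f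
      = 2 * Complex.I * k * ((∫ l in (-a ^ 2)..0, g l / absR c a l : ℝ) : ℂ) := by
  have h := integral_div_curveR_gap hac hf (b := 0) ⟨by nlinarith [sq_nonneg a], le_rfl⟩
  rw [aPeriod, intervalIntegral.integral_symm (-a ^ 2) 0]
  simp_rw [div_neg, intervalIntegral.integral_neg]
  rw [h]
  ring

lemma bPeriod_eq {c a : ℝ} (hac : a ^ 2 ≤ c ^ 2) {f : ℂ → ℂ} {k : ℂ} {g : ℝ → ℝ}
    (hf : ∀ l : ℝ, f l = k * g l) :
    bPeriod c a f
      = -(2 * k * ((∫ l in (-c ^ 2)..(-a ^ 2), g l / absR c a l : ℝ) : ℂ)) := by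
  rw [bPeriod, intervalIntegral.integral_symm (-c ^ 2) (-a ^ 2)]
  simp_rw [div_neg, intervalIntegral.integral_neg]
  rw [integral_div_curveR_cut hac hf]
  ring

/-! ### Closed forms of the periods and normalization constants -/

lemma gap_moment_zero {c a : ℝ} (ha : 0 < a) (hac : a < c) :
    ∫ l in (-a ^ 2)..0, 1 / absR c a l = 2 / c * ellK (a ^ 2 / c ^ 2) := by
  simpa using gap_moments ha hac 1 0 0

lemma cut_moment_zero {c a : ℝ} (ha : 0 < a) (hac : a < c) :
    ∫ l in (-c ^ 2)..(-a ^ 2), 1 / absR c a l = 2 / c * ellK (1 - a ^ 2 / c ^ 2) := by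
  simpa using cut_moments ha hac 1 0 0

lemma sq_le_sq_of_lt {c a : ℝ} (ha : 0 < a) (hac : a < c) : a ^ 2 ≤ c ^ 2 :=
  pow_le_pow_left₀ ha.le hac.le 2

lemma aPeriod_one {c a : ℝ} (ha : 0 < a) (hac : a < c) :
    aPeriod c a (fun _ => 1) = 4 * Complex.I / c * (ellK (a ^ 2 / c ^ 2) : ℂ) := by
  rw [aPeriod_eq (sq_le_sq_of_lt ha hac) (k := 1) (g := fun _ => 1) (by simp),
    gap_moment_zero ha hac]
  push_cast; ring

lemma ellK_ne_zero {c a : ℝ} (ha : 0 < a) (hac : a < c) : (ellK (a ^ 2 / c ^ 2) : ℂ) ≠ 0 :=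
  Complex.ofReal_ne_zero.2 (ellK_pos (modulus_mem ha hac).2).ne'

lemma normConst_eq {c a : ℝ} (ha : 0 < a) (hac : a < c) :
    normConst c a = ((Real.pi * c / (2 * ellK (a ^ 2 / c ^ 2)) : ℝ) : ℂ) := by
  have hc : (c : ℂ) ≠ 0 := Complex.ofReal_ne_zero.2 (ha.trans hac).ne'
  have hK := ellK_ne_zero ha hac
  rw [normConst, aPeriod_one ha hac]
  push_cast at hK ⊢
  field_simp [Complex.I_ne_zero]
  ring

lemma hConst_eq {c a : ℝ} (ha : 0 < a) (hac : a < c) :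
    hConst c a = ((-(c ^ 2 * (ellK (a ^ 2 / c ^ 2) - ellE (a ^ 2 / c ^ 2)) / ellK (a ^ 2 / c ^ 2)) :
      ℝ) : ℂ) := by
  have hc : (c : ℂ) ≠ 0 := Complex.ofReal_ne_zero.2 (ha.trans hac).ne'
  have hK := ellK_ne_zero ha hac
  have h1 := gap_moments ha hac 0 1 0
  simp only [zero_add, one_mul, zero_mul, add_zero, zero_sub] at h1
  rw [hConst, aPeriod_one ha hac, aPeriod_eq (sq_le_sq_of_lt ha hac) (k := 1) (g := fun l => l)
    (by simp), h1]
  generalize ellK (a ^ 2 / c ^ 2) = K at *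
  push_cast
  field_simp [Complex.I_ne_zero]
  ring

lemma waveNumber_eq {c a : ℝ} (ha : 0 < a) (hac : a < c) :
    waveNumber c a = ((Real.pi * c / ellK (a ^ 2 / c ^ 2) : ℝ) : ℂ) := by
  have hm := modulus_mem ha hac
  have hc := ha.trans hac
  have hK := ellK_pos hm.2
  have hL := legendre_relation hm.1 hm.2
  rw [waveNumber, bPeriod_eq (sq_le_sq_of_lt ha hac) (k := Complex.I / 2)
    (g := fun l => c ^ 2 * (ellK (a ^ 2 / c ^ 2) - ellE (a ^ 2 / c ^ 2)) / ellK (a ^ 2 / c ^ 2)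
      + 1 * l + 0 * l ^ 2) (by intro l; rw [dOmega₁, hConst_eq ha hac]; push_cast; ring),
    cut_moments ha hac]
  have e : ∀ r : ℂ, -(2 * (Complex.I / 2) * r) / Complex.I = -r := by
    intro r; field_simp [Complex.I_ne_zero]
  rw [e, ← Complex.ofReal_neg]
  congr 1
  generalize ellK (1 - a ^ 2 / c ^ 2) = K' at *
  generalize ellE (1 - a ^ 2 / c ^ 2) = E' at *
  field_simp
  linear_combination 6 * hL

lemma isNuPair_iff {c a : ℝ} (ha : 0 < a) (hac : a < c) (ν₁ ν₂ : ℝ) :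
    IsNuPair c a ν₁ ν₂ ↔ ν₁ * ν₂ = c ^ 4 * (a ^ 2 / c ^ 2 / 3 - (1 + a ^ 2 / c ^ 2)
        * (ellK (a ^ 2 / c ^ 2) - ellE (a ^ 2 / c ^ 2)) / (6 * ellK (a ^ 2 / c ^ 2)))
      ∧ ν₁ + ν₂ = -(c ^ 2 + a ^ 2) / 2 := by
  have hm := modulus_mem ha hac
  have hc := ha.trans hac
  have hK := ellK_pos hm.2
  have h2 : 2 * ν₁ + 2 * ν₂ + c ^ 2 + a ^ 2 = 0 ↔ ν₁ + ν₂ = -(c ^ 2 + a ^ 2) / 2 := by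
    constructor <;> intro h <;> linarith
  rw [IsNuPair, h2]
  refine and_congr_left fun hs => ?_
  rw [aPeriod_eq (sq_le_sq_of_lt ha hac) (k := -(3 * Complex.I / 2))
    (g := fun l => ν₁ * ν₂ + -(ν₁ + ν₂) * l + 1 * l ^ 2)
    (by intro l; rw [dOmega₃]; push_cast; ring), gap_moments ha hac, hs]
  have hI : (2 * Complex.I * -(3 * Complex.I / 2) : ℂ) ≠ 0 := by
    simp [Complex.I_ne_zero]
  rw [mul_eq_zero, or_iff_right hI, Complex.ofReal_eq_zero]
  generalize ellK (a ^ 2 / c ^ 2) = K at *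
  generalize ellE (a ^ 2 / c ^ 2) = E at *
  generalize ν₁ * ν₂ = p
  have e : p * (2 / c * K) - -(-(c ^ 2 + a ^ 2) / 2) * (2 * c * (K - E))
      + 1 * (2 * c ^ 3 * (2 * (1 + a ^ 2 / c ^ 2) * (K - E) - a ^ 2 / c ^ 2 * K) / 3)
      = 2 * K / c * (p - c ^ 4 * (a ^ 2 / c ^ 2 / 3 - (1 + a ^ 2 / c ^ 2) * (K - E) / (6 * K))) := by
    field_simp; ring
  rw [e, mul_eq_zero, or_iff_right (by positivity), sub_eq_zero]

/-- The sum and product of ν₁, ν₂ are prescribed. They are real because the discriminant is a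
positive multiple of ∫(λ + (c² + a²)/4)² dλ/|R| over the gap. -/
lemma exists_isNuPair {c a : ℝ} (ha : 0 < a) (hac : a < c) : ∃ ν₁ ν₂ : ℝ, IsNuPair c a ν₁ ν₂ := by
  have hm := modulus_mem ha hac
  have hc := ha.trans hac
  have hK := ellK_pos hm.2
  simp_rw [isNuPair_iff ha hac]
  have hpos : 0 ≤ ∫ l in (-a ^ 2)..0, (((c ^ 2 + a ^ 2) / 4) ^ 2 + (c ^ 2 + a ^ 2) / 2 * l
      + 1 * l ^ 2) / absR c a l := by
    refine intervalIntegral.integral_nonneg (by nlinarith [sq_nonneg a]) fun l _ =>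
      div_nonneg ?_ (Real.sqrt_nonneg _)
    nlinarith [sq_nonneg (l + (c ^ 2 + a ^ 2) / 4)]
  rw [gap_moments ha hac] at hpos
  set K := ellK (a ^ 2 / c ^ 2)
  set E := ellE (a ^ 2 / c ^ 2)
  set p := c ^ 4 * (a ^ 2 / c ^ 2 / 3 - (1 + a ^ 2 / c ^ 2) * (K - E) / (6 * K)) with hp
  have hdisc : 0 ≤ ((c ^ 2 + a ^ 2) / 4) ^ 2 - p := by
    have e : ((c ^ 2 + a ^ 2) / 4) ^ 2 - p = c / (2 * K) *
        (((c ^ 2 + a ^ 2) / 4) ^ 2 * (2 / c * K) - (c ^ 2 + a ^ 2) / 2 * (2 * c * (K - E))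
          + 1 * (2 * c ^ 3 * (2 * (1 + a ^ 2 / c ^ 2) * (K - E) - a ^ 2 / c ^ 2 * K) / 3)) := by
      rw [hp]; field_simp; ring
    rw [e]; positivity
  set d := Real.sqrt (((c ^ 2 + a ^ 2) / 4) ^ 2 - p) with hd
  have hd2 : d ^ 2 = ((c ^ 2 + a ^ 2) / 4) ^ 2 - p := Real.sq_sqrt hdisc
  refine ⟨-(c ^ 2 + a ^ 2) / 4 + d, -(c ^ 2 + a ^ 2) / 4 - d, ?_, by ring⟩
  linear_combination -hd2

lemma frequency_eq {c a : ℝ} (ha : 0 < a) (hac : a < c) {ν₁ ν₂ : ℝ} (hν : IsNuPair c a ν₁ ν₂) :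
    frequency c a ν₁ ν₂ = ((3 * (c ^ 4 * (a ^ 2 / c ^ 2 / 3 - (1 + a ^ 2 / c ^ 2)
        * (ellK (a ^ 2 / c ^ 2) - ellE (a ^ 2 / c ^ 2)) / (6 * ellK (a ^ 2 / c ^ 2)))
        * (2 / c * ellK (1 - a ^ 2 / c ^ 2)) - (c ^ 2 + a ^ 2) / 2
        * (2 * c * ellE (1 - a ^ 2 / c ^ 2))
        + 2 * c ^ 3 * (2 * (1 + a ^ 2 / c ^ 2) * ellE (1 - a ^ 2 / c ^ 2)
          - a ^ 2 / c ^ 2 * ellK (1 - a ^ 2 / c ^ 2)) / 3) : ℝ) : ℂ) := by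
  obtain ⟨hp, hs⟩ := (isNuPair_iff ha hac ν₁ ν₂).1 hν
  rw [frequency, bPeriod_eq (sq_le_sq_of_lt ha hac) (k := -(3 * Complex.I / 2))
    (g := fun l => ν₁ * ν₂ + -(ν₁ + ν₂) * l + 1 * l ^ 2)
    (by intro l; rw [dOmega₃]; push_cast; ring), cut_moments ha hac, hs, hp]
  have e : ∀ r : ℂ, -(2 * -(3 * Complex.I / 2) * r) / Complex.I = 3 * r := by
    intro r; field_simp [Complex.I_ne_zero]
  rw [e]
  push_cast
  ring

lemma tauTilde_eq {c a : ℝ} (ha : 0 < a) (hac : a < c) :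
    tauTilde c a = -(2 * Real.pi * (ellK (1 - a ^ 2 / c ^ 2) / ellK (a ^ 2 / c ^ 2))) := by
  have hc : (c : ℂ) ≠ 0 := Complex.ofReal_ne_zero.2 (ha.trans hac).ne'
  have hK := ellK_ne_zero ha hac
  rw [tauTilde, bPeriod_eq (sq_le_sq_of_lt ha hac) (k := normConst c a) (g := fun _ => 1) (by simp),
    cut_moment_zero ha hac, normConst_eq ha hac]
  generalize ellK (a ^ 2 / c ^ 2) = K at *
  push_cast
  field_simp

lemma tauRH_eq {c ξ : ℝ} (ha : 0 < aFun c ξ) (hac : aFun c ξ < c) :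
    tauRH c ξ = Complex.I * ((ellK (1 - aFun c ξ ^ 2 / c ^ 2) / ellK (aFun c ξ ^ 2 / c ^ 2) : ℝ)
      : ℂ) := by
  unfold tauRH
  generalize aFun c ξ = a at *
  have hc : (c : ℂ) ≠ 0 := Complex.ofReal_ne_zero.2 (ha.trans hac).ne'
  have hK := ellK_ne_zero ha hac
  have h1 := integral_div_curveR_cut (sq_le_sq_of_lt ha hac) (f := fun _ => 1) (k := 1)
    (g := fun _ => 1) (by simp)
  have h2 := integral_div_curveR_gap (sq_le_sq_of_lt ha hac) (f := fun _ => 1) (k := 1)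
    (g := fun _ => 1) (by simp) (b := 0) ⟨by nlinarith [sq_nonneg a], le_rfl⟩
  rw [h1, h2, gap_moment_zero ha hac, cut_moment_zero ha hac]
  generalize ellK (a ^ 2 / c ^ 2) = K at *
  push_cast
  field_simp [Complex.I_ne_zero]
  linear_combination (-(ellK (1 - a ^ 2 / c ^ 2) : ℂ)) * Complex.I_sq

/-- The half-axis contributes πi and the cut τ̃/2. The Riemann constant cancels the latter and adds
another πi. -/
lemma abelMap_eq {c a : ℝ} (ha : 0 < a) (hac : a < c) (p : Surface c a) :
    abelMap p + riemannConst c a = 2 * Real.pi * Complex.I + gapIntegral p := by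
  have hc : (c : ℂ) ≠ 0 := Complex.ofReal_ne_zero.2 (ha.trans hac).ne'
  have hK := ellK_ne_zero ha hac
  have h1 : ∫ l in Iic (-c ^ 2 : ℝ), normConst c a / curveR c a l
      = normConst c a * Complex.I * ((2 / c * ellK (a ^ 2 / c ^ 2) : ℝ) : ℂ) := by
    rw [← integral_left ha hac, ← integral_complex_ofReal, ← integral_const_mul]
    refine setIntegral_congr_fun measurableSet_Iic fun l hl => ?_
    rw [curveR_left (sq_le_sq_of_lt ha hac) hl, div_neg, div_mul_eq_div_div_swap, Complex.div_I]
    push_cast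
    ring
  have h2 := integral_div_curveR_cut (sq_le_sq_of_lt ha hac) (f := fun _ => normConst c a)
    (k := normConst c a) (g := fun _ => 1) (by simp)
  rw [abelMap, riemannConst, h1, h2, cut_moment_zero ha hac, tauTilde_eq ha hac,
    normConst_eq ha hac]
  generalize ellK (a ^ 2 / c ^ 2) = K at *
  push_cast
  field_simp
  ring

/-! ### Theta functions -/

/-- For purely imaginary `τ` the theta function `θ₃` is positive on the real line. -/
lemma jacobiTheta₂_ofReal_pos {t : ℝ} (ht : 0 < t) (v : ℝ) :
    ∃ r : ℝ, 0 < r ∧ jacobiTheta₂ (v : ℂ) (Complex.I * t) = r := by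
  have htc : (t : ℂ) ≠ 0 := Complex.ofReal_ne_zero.2 ht.ne'
  -- The terms of θ₃ itself oscillate; after the modular transformation τ ↦ -1/τ they become real
  -- exponentials, and positivity is evident.
  have hterm : ∀ n : ℤ, jacobiTheta₂_term n ((v : ℂ) / (Complex.I * t)) (-1 / (Complex.I * t))
      = ((Real.exp (2 * Real.pi * n * v / t - Real.pi * n ^ 2 / t) : ℝ) : ℂ) := by
    intro n
    rw [jacobiTheta₂_term, Complex.ofReal_exp]
    congr 1
    push_cast
    field_simp [Complex.I_ne_zero]
    ring
  have hsum : Summable fun n : ℤ => Real.exp (2 * Real.pi * n * v / t - Real.pi * n ^ 2 / t) := by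
    have him : 0 < (-1 / (Complex.I * t) : ℂ).im := by
      have : (-1 / (Complex.I * t) : ℂ) = Complex.I * ((1 / t : ℝ) : ℂ) := by
        push_cast
        field_simp [Complex.I_ne_zero]
        simp
      rw [this, Complex.I_mul_im, Complex.ofReal_re]
      positivity
    have := (summable_jacobiTheta₂_term_iff ((v : ℂ) / (Complex.I * t)) _).2 him
    simp_rw [hterm] at this
    exact Complex.summable_ofReal.1 this
  refine ⟨1 / t ^ (1 / 2 : ℝ) * Real.exp (-Real.pi * v ^ 2 / t)
    * ∑' n : ℤ, Real.exp (2 * Real.pi * n * v / t - Real.pi * n ^ 2 / t), ?_, ?_⟩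
  · have := hsum.tsum_pos (fun n => (Real.exp_pos _).le) 0 (Real.exp_pos _)
    have := Real.rpow_pos_of_pos ht (1 / 2 : ℝ)
    positivity
  · rw [jacobiTheta₂_functional_equation, jacobiTheta₂]
    simp_rw [hterm]
    rw [← Complex.ofReal_tsum]
    have h1 : -Complex.I * (Complex.I * t) = t := by
      linear_combination (-(t : ℂ)) * Complex.I_sq
    have h2 : -(Real.pi : ℂ) * Complex.I * (v : ℂ) ^ 2 / (Complex.I * t)
        = ((-Real.pi * v ^ 2 / t : ℝ) : ℂ) := by
      push_cast
      field_simp [Complex.I_ne_zero]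
    rw [h1, h2, ← Complex.ofReal_exp]
    push_cast [Complex.ofReal_cpow ht.le]
    norm_num

lemma contDiff_log_jacobiTheta₂ {t : ℝ} (ht : 0 < t) {n : ℕ} :
    ContDiff ℝ n fun v : ℝ => Complex.log (jacobiTheta₂ (v : ℂ) (Complex.I * t)) := by
  have him : 0 < (Complex.I * t : ℂ).im := by simpa using ht
  have hd : Differentiable ℂ fun z => jacobiTheta₂ z (Complex.I * t) :=
    fun z => differentiableAt_jacobiTheta₂_fst z him
  have h1 : ContDiff ℝ n fun z => jacobiTheta₂ z (Complex.I * t) :=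
    (hd.contDiff (n := n)).restrict_scalars ℝ
  have h2 : ContDiff ℝ n fun v : ℝ => jacobiTheta₂ (v : ℂ) (Complex.I * t) :=
    h1.comp Complex.ofRealCLM.contDiff
  rw [contDiff_iff_contDiffAt]
  intro v
  refine ContDiffAt.comp v ((Complex.contDiffAt_log ?_).restrict_scalars ℝ) h2.contDiffAt
  obtain ⟨r, hr, h⟩ := jacobiTheta₂_ofReal_pos ht v
  rw [h]
  exact Complex.ofReal_mem_slitPlane.2 hr

lemma theta_eq {c a : ℝ} (ha : 0 < a) (hac : a < c) (z : ℂ) :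
    theta c a z = jacobiTheta₂ (z / (2 * Real.pi * Complex.I))
      (Complex.I * ((ellK (1 - a ^ 2 / c ^ 2) / ellK (a ^ 2 / c ^ 2) : ℝ) : ℂ)) := by
  have hpi : (Real.pi : ℂ) ≠ 0 := Complex.ofReal_ne_zero.2 Real.pi_ne_zero
  rw [theta, jacobiTheta₂]
  refine tsum_congr fun n => ?_
  rw [jacobiTheta₂_term, tauTilde_eq ha hac]
  congr 1
  push_cast
  have e : 2 * (Real.pi : ℂ) * Complex.I * n * (z / (2 * Real.pi * Complex.I)) = z * n := by
    field_simp [Complex.I_ne_zero]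
  rw [e]
  linear_combination (-(Real.pi : ℂ) * n ^ 2 * (ellK (1 - a ^ 2 / c ^ 2) / ellK (a ^ 2 / c ^ 2)))
    * Complex.I_sq

lemma jacobiTheta₂_sub_int (z τ : ℂ) (n : ℤ) : jacobiTheta₂ (z - n) τ = jacobiTheta₂ z τ := by
  have h : Function.Periodic (fun z => jacobiTheta₂ z τ) 1 := fun z => jacobiTheta₂_add_left z τ
  simpa using h.sub_int_mul_eq (x := z) n

/-! ### The Jacobi inversion problem -/

/-- The normalized Abel map `[-a², 0] → [0, 1]` along the gap. -/
def gapCoord (c a l : ℝ) : ℝ :=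
  (2 / c * ellK (a ^ 2 / c ^ 2))⁻¹ * ∫ u in (-a ^ 2)..l, 1 / absR c a u

lemma absR_pos_of_mem_gap {c a l : ℝ} (hac : a ^ 2 ≤ c ^ 2) (hl : l ∈ Ioo (-a ^ 2) 0) :
    0 < absR c a l := by
  have h1 : 0 < l + a ^ 2 := by linarith [hl.1]
  have h2 : 0 < l + c ^ 2 := by linarith
  exact Real.sqrt_pos.2 (abs_pos.2 (mul_ne_zero (mul_ne_zero hl.2.ne h2.ne') h1.ne'))

section Inversion

variable {c a : ℝ}

lemma gapLength_pos (ha : 0 < a) (hac : a < c) : 0 < 2 / c * ellK (a ^ 2 / c ^ 2) :=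
  mul_pos (div_pos two_pos (ha.trans hac)) (ellK_pos (modulus_mem ha hac).2)

lemma intervalIntegrable_inv_absR (ha : 0 < a) (hac : a < c) :
    IntervalIntegrable (fun l => 1 / absR c a l) volume (-a ^ 2) 0 := by
  -- A non-integrable function has integral 0 by convention, whereas this integral is already known
  -- to be positive.
  by_contra h
  have h0 := intervalIntegral.integral_undef h
  rw [gap_moment_zero ha hac] at h0
  exact (gapLength_pos ha hac).ne' h0

lemma gapCoord_left : gapCoord c a (-a ^ 2) = 0 := by simp [gapCoord]

lemma gapCoord_right (ha : 0 < a) (hac : a < c) : gapCoord c a 0 = 1 := by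
  rw [gapCoord, gap_moment_zero ha hac, inv_mul_cancel₀ (gapLength_pos ha hac).ne']

lemma neg_sq_le_zero : -a ^ 2 ≤ 0 := by nlinarith [sq_nonneg a]

lemma continuousOn_gapCoord (ha : 0 < a) (hac : a < c) :
    ContinuousOn (gapCoord c a) (Icc (-a ^ 2) 0) := by
  have h := intervalIntegral.continuousOn_primitive_interval' (intervalIntegrable_inv_absR ha hac)
    left_mem_uIcc
  rw [uIcc_of_le neg_sq_le_zero] at h
  exact continuousOn_const.mul h

lemma strictMonoOn_gapCoord (ha : 0 < a) (hac : a < c) :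
    StrictMonoOn (gapCoord c a) (Icc (-a ^ 2) 0) := by
  intro x hx y hy hxy
  have hint := intervalIntegrable_inv_absR ha hac
  have hsub : ∀ u v : ℝ, u ∈ Icc (-a ^ 2) 0 → v ∈ Icc (-a ^ 2) 0 →
      IntervalIntegrable (fun l => 1 / absR c a l) volume u v := fun u v hu hv =>
    hint.mono_set (by rw [uIcc_of_le neg_sq_le_zero]; exact uIcc_subset_Icc hu hv)
  have hl := left_mem_Icc.2 (neg_sq_le_zero (a := a))
  refine mul_lt_mul_of_pos_left ?_ (inv_pos.2 (gapLength_pos ha hac))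
  rw [← intervalIntegral.integral_add_adjacent_intervals (hsub _ _ hl hx) (hsub _ _ hx hy)]
  have : 0 < ∫ u in x..y, 1 / absR c a u :=
    intervalIntegral.intervalIntegral_pos_of_pos_on (hsub _ _ hx hy)
      (fun u hu => one_div_pos.2 (absR_pos_of_mem_gap (sq_le_sq_of_lt ha hac)
        ⟨hx.1.trans_lt hu.1, hu.2.trans_le hy.2⟩)) hxy
  linarith

lemma gapCoord_mem (ha : 0 < a) (hac : a < c) {l : ℝ} (hl : l ∈ Icc (-a ^ 2) 0) :
    gapCoord c a l ∈ Icc (0 : ℝ) 1 := by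
  have hm := (strictMonoOn_gapCoord ha hac).monotoneOn
  rw [← gapCoord_left (c := c) (a := a), ← gapCoord_right ha hac]
  exact ⟨hm (left_mem_Icc.2 neg_sq_le_zero) hl hl.1, hm hl (right_mem_Icc.2 neg_sq_le_zero) hl.2⟩

lemma exists_gapCoord_eq (ha : 0 < a) (hac : a < c) {s : ℝ} (hs : s ∈ Icc (0 : ℝ) 1) :
    ∃ l ∈ Icc (-a ^ 2) 0, gapCoord c a l = s := by
  have h := intermediate_value_Icc neg_sq_le_zero (continuousOn_gapCoord ha hac)
  rw [gapCoord_left, gapCoord_right ha hac] at h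
  exact h hs

lemma integral_normConst_gap (ha : 0 < a) (hac : a < c) {l : ℝ} (hl : l ∈ Icc (-a ^ 2) 0) :
    ∫ u in (-a ^ 2)..l, normConst c a / curveR c a u
      = -(Real.pi * gapCoord c a l * Complex.I) := by
  have hc : (c : ℂ) ≠ 0 := Complex.ofReal_ne_zero.2 (ha.trans hac).ne'
  have hK := ellK_ne_zero ha hac
  have h := integral_div_curveR_gap (sq_le_sq_of_lt ha hac) (f := fun _ => normConst c a)
    (k := normConst c a) (g := fun _ => 1) (by simp) hl
  rw [h, normConst_eq ha hac, gapCoord]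
  generalize (∫ u in (-a ^ 2)..l, 1 / absR c a u) = J
  generalize ellK (a ^ 2 / c ^ 2) = K at *
  push_cast
  field_simp

lemma curveR_sq_gap (hac : a ^ 2 ≤ c ^ 2) {l : ℝ} (hl : l ∈ Icc (-a ^ 2) 0) :
    curveR c a l ^ 2 = (l : ℂ) * (l + (c : ℂ) ^ 2) * (l + (a : ℂ) ^ 2) := by
  have h1 : 0 ≤ l + a ^ 2 := by linarith [hl.1]
  have h2 : 0 ≤ l + c ^ 2 := by linarith
  have hn : l * (l + c ^ 2) * (l + a ^ 2) ≤ 0 :=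
    mul_nonpos_of_nonpos_of_nonneg (mul_nonpos_of_nonpos_of_nonneg hl.2 h2) h1
  have h : absR c a l ^ 2 = -(l * (l + c ^ 2) * (l + a ^ 2)) := by
    rw [absR, Real.sq_sqrt (abs_nonneg _), abs_of_nonpos hn]
  have h' : (absR c a l : ℂ) ^ 2 = -((l : ℂ) * (l + (c : ℂ) ^ 2) * (l + (a : ℂ) ^ 2)) := by
    exact_mod_cast h
  rw [curveR_gap hac hl, mul_pow, Complex.I_sq, h']
  ring

/-- The Abel integral of a point over the gap is `-πiσ` with `σ ∈ (-1, 1]`; the sign of `σ`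
determines the sheet and `|σ|` the projection. -/
lemma gapIntegral_eq (ha : 0 < a) (hac : a < c) (p : Surface c a) {l : ℝ}
    (hl : l ∈ Icc (-a ^ 2) 0) (hp : p.proj = l) :
    ∃ σ ∈ Ioc (-1 : ℝ) 1, gapIntegral p = -(Real.pi * σ * Complex.I) ∧
      ((0 ≤ σ ∧ p.1.2 = curveR c a l ∧ gapCoord c a l = σ) ∨
        (σ < 0 ∧ p.1.2 = -curveR c a l ∧ gapCoord c a l = -σ)) := by
  have hmem := gapCoord_mem ha hac hl
  have hre : p.proj.re = l := by rw [hp, Complex.ofReal_re]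
  by_cases h : p.1.2 = curveR c a l
  · refine ⟨gapCoord c a l, ⟨by linarith [hmem.1], hmem.2⟩, ?_, Or.inl ⟨hmem.1, h, rfl⟩⟩
    rw [gapIntegral, if_pos (by rw [hp]; exact h), hre, integral_normConst_gap ha hac hl]
  · have hsq : p.1.2 ^ 2 = curveR c a l ^ 2 := by
      have hp' : p.1.1 = l := hp
      rw [curveR_sq_gap (sq_le_sq_of_lt ha hac) hl, p.2, hp']
    have hneg : p.1.2 = -curveR c a l := (sq_eq_sq_iff_eq_or_eq_neg.1 hsq).resolve_left h
    -- At the branch points the two signs of y coincide and the first case applies. Hence the second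
    -- case lives strictly inside the gap, and -1 is excluded from the range of σ.
    have hne : curveR c a l ≠ 0 := by
      intro h0; exact h (by rw [hneg, h0, neg_zero])
    have hR : absR c a l ≠ 0 := by
      intro h0; exact hne (by rw [curveR_gap (sq_le_sq_of_lt ha hac) hl, h0]; simp)
    have hl1 : -a ^ 2 < l := by
      refine lt_of_le_of_ne hl.1 ?_
      rintro rfl; exact hR (by simp [absR])
    have hl2 : l < 0 := by
      refine lt_of_le_of_ne hl.2 ?_
      rintro rfl; exact hR (by simp [absR])
    have hm := strictMonoOn_gapCoord ha hac
    have h0 : 0 < gapCoord c a l := by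
      rw [← gapCoord_left (c := c) (a := a)]
      exact hm (left_mem_Icc.2 neg_sq_le_zero) hl hl1
    have h1 : gapCoord c a l < 1 := by
      rw [← gapCoord_right ha hac]
      exact hm hl (right_mem_Icc.2 neg_sq_le_zero) hl2
    refine ⟨-gapCoord c a l, ⟨by linarith, by linarith⟩, ?_,
      Or.inr ⟨by linarith, hneg, by ring⟩⟩
    rw [gapIntegral, if_neg (by rw [hp]; exact h), hre]
    simp_rw [div_neg, intervalIntegral.integral_neg]
    rw [integral_normConst_gap ha hac hl]
    push_cast; ring

lemma exists_gapIntegral_eq (ha : 0 < a) (hac : a < c) {σ : ℝ} (hσ : σ ∈ Ioc (-1 : ℝ) 1) :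
    ∃ p : Surface c a, p.InGap ∧ gapIntegral p = -(Real.pi * σ * Complex.I) := by
  rcases le_or_gt 0 σ with h | h
  · obtain ⟨l, hl, hls⟩ := exists_gapCoord_eq ha hac (s := σ) ⟨h, hσ.2⟩
    obtain ⟨p, hp₁, hp₂⟩ : ∃ p : Surface c a, p.proj = l ∧ p.1.2 = curveR c a l :=
      ⟨⟨(l, curveR c a l), curveR_sq_gap (sq_le_sq_of_lt ha hac) hl⟩, rfl, rfl⟩
    refine ⟨p, ⟨l, hl, hp₁⟩, ?_⟩
    rw [gapIntegral, if_pos (by rw [hp₁, hp₂]), hp₁, Complex.ofReal_re,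
      integral_normConst_gap ha hac hl, hls]
  · obtain ⟨l, hl, hls⟩ := exists_gapCoord_eq ha hac (s := -σ) ⟨by linarith, by linarith [hσ.1]⟩
    have hl1 : -a ^ 2 < l := by
      refine lt_of_le_of_ne hl.1 ?_
      rintro rfl; rw [gapCoord_left] at hls; linarith
    have hl2 : l < 0 := by
      refine lt_of_le_of_ne hl.2 ?_
      rintro rfl; rw [gapCoord_right ha hac] at hls; linarith [hσ.1]
    have hne : curveR c a l ≠ 0 := by
      rw [curveR_gap (sq_le_sq_of_lt ha hac) hl]
      exact mul_ne_zero Complex.I_ne_zero (Complex.ofReal_ne_zero.2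
        (absR_pos_of_mem_gap (sq_le_sq_of_lt ha hac) ⟨hl1, hl2⟩).ne')
    obtain ⟨p, hp₁, hp₂⟩ : ∃ p : Surface c a, p.proj = l ∧ p.1.2 = -curveR c a l :=
      ⟨⟨(l, -curveR c a l), by simpa using curveR_sq_gap (sq_le_sq_of_lt ha hac) hl⟩, rfl, rfl⟩
    refine ⟨p, ⟨l, hl, hp₁⟩, ?_⟩
    rw [gapIntegral, if_neg (by rw [hp₁, hp₂]; exact fun h => hne (neg_eq_self.1 h)), hp₁,
      Complex.ofReal_re]
    simp_rw [div_neg, intervalIntegral.integral_neg]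
    rw [integral_normConst_gap ha hac hl, hls]
    push_cast; ring

/-- The points over the gap form a circle with coordinate σ ∈ (-1, 1], and the 𝔞-period 2πi
corresponds to σ modulo 2. The solution is the representative of Δ/π in this interval. -/
lemma existsUnique_jacobi_inversion (ha : 0 < a) (hac : a < c) (Δ : ℝ) :
    ∃! p : Surface c a, p.InGap ∧ ∃ n : ℤ,
      gapIntegral p = -(Complex.I * Δ) + 2 * Real.pi * Complex.I * n := by
  have hpi : (Real.pi : ℂ) ≠ 0 := Complex.ofReal_ne_zero.2 Real.pi_ne_zero
  obtain ⟨σ, hσ, n, hn⟩ : ∃ σ ∈ Ioc (-1 : ℝ) 1, ∃ n : ℤ, Δ / Real.pi = σ + 2 * n := by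
    refine ⟨toIocMod two_pos (-1 : ℝ) (Δ / Real.pi), ?_, toIocDiv two_pos (-1 : ℝ) (Δ / Real.pi),
      ?_⟩
    · have := toIocMod_mem_Ioc (two_pos (α := ℝ)) (-1) (Δ / Real.pi)
      norm_num at this ⊢
      exact this
    · have := toIocMod_add_toIocDiv_mul (two_pos (α := ℝ)) (-1) (Δ / Real.pi)
      linarith
  have hΔ : (Δ : ℂ) = Real.pi * (σ + 2 * n) := by
    rw [div_eq_iff Real.pi_ne_zero] at hn
    rw [hn]; push_cast; ring
  obtain ⟨p, hp, hpσ⟩ := exists_gapIntegral_eq ha hac hσ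
  have huniq : ∀ q : Surface c a, ∀ l ∈ Icc (-a ^ 2) (0 : ℝ), q.proj = l → ∀ k : ℤ,
      gapIntegral q = -(Complex.I * Δ) + 2 * Real.pi * Complex.I * k →
      (0 ≤ σ ∧ q.1.2 = curveR c a l ∧ gapCoord c a l = σ) ∨
        (σ < 0 ∧ q.1.2 = -curveR c a l ∧ gapCoord c a l = -σ) := by
    intro q l hl hql k hk
    obtain ⟨σ', hσ', hq, hcase⟩ := gapIntegral_eq ha hac q hl hql
    have he : (σ' : ℂ) = σ + 2 * n - 2 * k := by
      rw [hq, hΔ] at hk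
      have h2 : (Real.pi : ℂ) * Complex.I * (σ' - (σ + 2 * n - 2 * k)) = 0 := by
        linear_combination -hk
      rcases mul_eq_zero.1 h2 with h3 | h3
      · exact absurd h3 (mul_ne_zero hpi Complex.I_ne_zero)
      · linear_combination h3
    have he' : σ' = σ + 2 * n - 2 * k := by exact_mod_cast he
    -- σ and σ' lie in one half-open interval of length 2 and differ by 2(n - k).
    have hnk : n = k := by
      have h1 : (n : ℝ) - k < 1 := by linarith [hσ.1, hσ'.2]
      have h2 : (-1 : ℝ) < n - k := by linarith [hσ.2, hσ'.1]
      have h1' : n - k < 1 := by exact_mod_cast h1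
      have h2' : -1 < n - k := by exact_mod_cast h2
      omega
    have : σ' = σ := by rw [he', hnk]; ring
    rwa [this] at hcase
  have hpk : gapIntegral p = -(Complex.I * Δ) + 2 * Real.pi * Complex.I * n := by
    rw [hpσ, hΔ]; ring
  refine ⟨p, ⟨hp, n, hpk⟩, ?_⟩
  rintro q ⟨⟨l, hl, hql⟩, k, hk⟩
  obtain ⟨l', hl', hpl⟩ := hp
  have hinj := (strictMonoOn_gapCoord ha hac).injOn
  have key : l = l' ∧ q.1.2 = p.1.2 := by
    rcases huniq q l hl hql k hk with ⟨h1, h2, h3⟩ | ⟨h1, h2, h3⟩ <;>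
    rcases huniq p l' hl' hpl n hpk with ⟨h1', h2', h3'⟩ | ⟨h1', h2', h3'⟩
    · have := hinj hl hl' (h3.trans h3'.symm)
      exact ⟨this, by rw [h2, h2', this]⟩
    · linarith
    · linarith
    · have := hinj hl hl' (h3.trans h3'.symm)
      exact ⟨this, by rw [h2, h2', this]⟩
  refine Subtype.ext (Prod.ext ?_ key.2)
  change q.proj = p.proj
  rw [hql, hpl, key.1]

end Inversion

/-! ### Comparison of the two formulas -/

/-- The phases agree: `12 ξ V - 4 W = B(ξ)`. -/
lemma phaseB_eq {c ξ : ℝ} (hc : 0 < c) (hξ : ξ ∈ Ioo (-c ^ 2 / 2) (c ^ 2 / 3)) {ν₁ ν₂ : ℝ}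
    (hν : IsNuPair c (aFun c ξ) ν₁ ν₂) :
    12 * ξ * waveNumber c (aFun c ξ) - 4 * frequency c (aFun c ξ) ν₁ ν₂ = (phaseB c ξ : ℂ) := by
  obtain ⟨ha, hac, -⟩ := aFun_spec hc hξ
  have hm := modulus_mem ha hac
  have hX := modX_aFun hc hξ
  rw [waveNumber_eq ha hac, frequency_eq ha hac hν, phaseB, phase_integral ha hac]
  have hK := (ellK_pos hm.2).ne'
  have hD := (ellE_sub_pos hm.1 hm.2).ne'
  have hL := legendre_relation hm.1 hm.2
  have haa : aFun c ξ ^ 2 = c ^ 2 * (aFun c ξ ^ 2 / c ^ 2) := by field_simp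
  rw [haa]
  rw [mul_div_cancel_left₀ _ (show c ^ 2 ≠ 0 by positivity)]
  generalize aFun c ξ ^ 2 / c ^ 2 = m at *
  -- The branch equation cleared of denominators. Together with Legendre's relation solved for π, it
  -- is all that the identity requires.
  have hX' : 6 * ξ * (ellE m - (1 - m) * ellK m)
      = c ^ 2 * ((1 + m) * ellE m - (1 - m) * (1 + 3 * m) * ellK m) := by
    rw [← hX, modX]; field_simp; ring
  have hpi : Real.pi = 2 * (ellE (1 - m) * ellK m + ellE m * ellK (1 - m)
    - ellK m * ellK (1 - m)) := by rw [hL]; ring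
  rw [hpi]
  norm_cast
  field_simp
  linear_combination 48 * ellK (1 - m) * hX'

/-- The Its–Matveev phase on the real line, in terms of `θ₃`. -/
lemma logThetaIM_eq {c ξ : ℝ} (hc : 0 < c) (hξ : ξ ∈ Ioo (-c ^ 2 / 2) (c ^ 2 / 3)) {q₀ : ℝ → ℝ}
    {ν₁ ν₂ : ℝ} {p₀ : Surface c (aFun c ξ)} (hν : IsNuPair c (aFun c ξ) ν₁ ν₂)
    (hp : SolvesJacobi c q₀ ξ p₀) {x t : ℝ} (hx : x = 12 * t * ξ) {V : ℝ}
    (hV : waveNumber c (aFun c ξ) = V) (y : ℝ) :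
    logThetaIM c (aFun c ξ) ν₁ ν₂ p₀ t y = logThetaRH c q₀ ξ t (V / (2 * Real.pi) * (y - x)) := by
  obtain ⟨ha, hac, -⟩ := aFun_spec hc hξ
  obtain ⟨-, n, hn⟩ := hp
  have hpi : (Real.pi : ℂ) ≠ 0 := Complex.ofReal_ne_zero.2 Real.pi_ne_zero
  have hB := phaseB_eq hc hξ hν
  have hA := abelMap_eq ha hac p₀
  rw [hn] at hA
  -- The integer shift collects n from the Jacobi problem and 1 from the 2πi in A(p₀) + 𝒦.
  rw [logThetaIM, logThetaRH, theta_eq ha hac, tauRH_eq ha hac,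
    ← jacobiTheta₂_sub_int _ _ (-(n + 1))]
  congr 2
  rw [hV] at hB ⊢
  push_cast
  rw [← hB, hx]
  push_cast
  field_simp [Complex.I_ne_zero]
  linear_combination -hA

lemma contDiff_logThetaRH {c ξ : ℝ} (hc : 0 < c) (hξ : ξ ∈ Ioo (-c ^ 2 / 2) (c ^ 2 / 3))
    (q₀ : ℝ → ℝ) (t : ℝ) : ContDiff ℝ 2 (logThetaRH c q₀ ξ t) := by
  obtain ⟨ha, hac, -⟩ := aFun_spec hc hξ
  have hm := modulus_mem ha hac
  have h := contDiff_log_jacobiTheta₂ (n := 2) (div_pos (ellK_pos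
    (show 1 - aFun c ξ ^ 2 / c ^ 2 < 1 by linarith [hm.1])) (ellK_pos hm.2))
  rw [← tauRH_eq ha hac] at h
  exact h.comp (contDiff_const.add contDiff_id)

end KdVShock

end

/-! ### Conclusion: matching the coefficients and the constant terms -/

theorem mainTheorem1 (c C₀ : ℝ) (hc : 0 < c) (hC₀ : c < C₀) (q₀ : ℝ → ℝ)
    (hmeas : MeasureTheory.AEStronglyMeasurable q₀ MeasureTheory.volume)
    (hdecay : MeasureTheory.IntegrableOn
      (fun x : ℝ => Real.exp (C₀ * x) * (|q₀ x| + |q₀ (-x) + c ^ 2|)) (Set.Ioi 0))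
    (ξ : ℝ) (hξ : ξ ∈ Set.Ioo (-c ^ 2 / 2) (c ^ 2 / 3)) :
    -- the data entering the two formulas are well defined
    (∃! a : ℝ, KdVShock.IsBranchParam c ξ a) ∧
    DifferentiableAt ℝ (KdVShock.phaseB c) ξ ∧
    DifferentiableAt ℝ (KdVShock.zRH c) ξ ∧
    (∃ ν₁ ν₂ : ℝ, KdVShock.IsNuPair c (KdVShock.aFun c ξ) ν₁ ν₂) ∧
    -- the Jacobi inversion problem is uniquely solvable
    (∃! p₀ : KdVShock.Surface c (KdVShock.aFun c ξ), KdVShock.SolvesJacobi c q₀ ξ p₀) ∧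
    -- the profile is the one-gap solution with the Dirichlet divisor so determined
    ∀ (ν₁ ν₂ : ℝ) (p₀ : KdVShock.Surface c (KdVShock.aFun c ξ)),
      KdVShock.IsNuPair c (KdVShock.aFun c ξ) ν₁ ν₂ →
      KdVShock.SolvesJacobi c q₀ ξ p₀ →
      ∀ x t : ℝ, t ≠ 0 → x / (12 * t) = ξ →
        ContDiff ℝ 2 (KdVShock.logThetaRH c q₀ ξ t) ∧
        ContDiff ℝ 2 (KdVShock.logThetaIM c (KdVShock.aFun c ξ) ν₁ ν₂ p₀ t) ∧
        KdVShock.qRH c q₀ x t = KdVShock.qIM c (KdVShock.aFun c ξ) ν₁ ν₂ p₀ x t := by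
  obtain ⟨ha, hac, -⟩ := KdVShock.aFun_spec hc hξ
  refine ⟨KdVShock.existsUnique_isBranchParam hc hξ,
    (KdVShock.hasDerivAt_phaseB hc hξ rfl).differentiableAt,
    (KdVShock.hasDerivAt_zRH hc hξ rfl).differentiableAt,
    KdVShock.exists_isNuPair ha hac,
    KdVShock.existsUnique_jacobi_inversion ha hac _, ?_⟩
  intro ν₁ ν₂ p₀ hν hp x t ht hxt
  have hx : x = 12 * t * ξ := by
    rw [div_eq_iff (by positivity)] at hxt
    linarith
  have hV := KdVShock.waveNumber_eq ha hac
  have hK := KdVShock.ellK_pos (KdVShock.modulus_mem ha hac).2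
  have hRH := KdVShock.contDiff_logThetaRH hc hξ q₀ t
  have hIM := funext (KdVShock.logThetaIM_eq hc hξ hν hp hx hV)
  refine ⟨hRH, ?_, ?_⟩
  · rw [hIM]
    exact hRH.comp (by fun_prop)
  · rw [KdVShock.qRH, KdVShock.qIM, hxt, hIM, (KdVShock.hasDerivAt_phaseB hc hξ rfl).deriv,
      (KdVShock.hasDerivAt_zRH hc hξ rfl).deriv, KdVShock.gammaRH, KdVShock.gapInt_eq ha hac,
      KdVShock.hConst_eq ha hac]
    -- The Its–Matveev logarithm is the other one composed with y ↦ (V/2π)(y - x), so its second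
    -- derivative at x gains (V/2π)² and is taken at 0.
    have hshift := iteratedDeriv_comp_sub_const 2 (fun y => KdVShock.logThetaRH c q₀ ξ t
      (Real.pi * c / KdVShock.ellK (KdVShock.aFun c ξ ^ 2 / c ^ 2) / (2 * Real.pi) * y)) x
    rw [hshift, iteratedDeriv_comp_const_smul hRH]
    -- Once a² is written as c²m, what remains is a rational identity in m, K, E, c and π.
    have haa : (KdVShock.aFun c ξ : ℂ) ^ 2
        = (c : ℂ) ^ 2 * ((KdVShock.aFun c ξ ^ 2 / c ^ 2 : ℝ) : ℂ) := by
      push_cast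
      have : (c : ℂ) ≠ 0 := Complex.ofReal_ne_zero.2 hc.ne'
      field_simp
    rw [haa]
    generalize KdVShock.aFun c ξ ^ 2 / c ^ 2 = m at *
    have hKc : (KdVShock.ellK m : ℂ) ≠ 0 := Complex.ofReal_ne_zero.2 hK.ne'
    have hcc : (c : ℂ) ≠ 0 := Complex.ofReal_ne_zero.2 hc.ne'
    have hpi : (Real.pi : ℂ) ≠ 0 := Complex.ofReal_ne_zero.2 Real.pi_ne_zero
    simp only [sub_self, mul_zero, Complex.real_smul]
    push_cast
    field_simp
    ring
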